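/- Let $G=(V,E)$ be a finite directed graph, $E\subset V\times V$, without loops; the edge $e=(x,y)$ has origin $\underline e=x$ and destination $\overline e=y$. Let $V=U\sqcup\{\delta\}$ and $x_0\in U$ be such that no edge has origin $\delta$, for every $x\in U$ there is a directed simple path from $x$ to $\delta$, and for every $x\in U$, $x\ne x_0$, there is a directed simple path from $x_0$ to $x$. Simple paths and simple cycles are sets of distinct edges $\{e_1,\dots,e_k\}$ running through distinct vertices, the edges being allowed to be traversed in either direction (a path or cycle is directed if all its edges are traversed in their own direction). A spanning tree is a set $T\subset E$ that contains no simple cycle and contains a simple path between any two distinct vertices; $\mathcal T$ is the set of spanning trees. Let $\mathcal H=\{z\in\mathbb R^E:\ \sum_{\underline e=x}z_e-\sum_{\overline e=x}z_e=\mathbf 1_{x=x_0}\ \text{for all } x\in U\}$ and $\Delta=\{z\in\mathcal H:\ z_e>0\ \text{for all } e\in E\}$. For $T\in\mathcal T$ the functions $(z_e)_{e\in T^c}$ are affine coordinates on $\mathcal H$; put $\omega_T=\bigwedge_{e\in T^c}\frac{dz_e}{z_e}$, ordered so that it is positively oriented on $\Delta$. Let $(\alpha_e)_{e\in E}$ be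 real weights such that the integrals $$I_{\Delta,T}(\lambda)=\int_\Delta e^{-\langle\lambda,z\rangle}\prod_{e\in E}z_e^{\alpha_e}\,\omega_T,\qquad \langle\lambda,z\rangle=\sum_{e\in E}\lambda_e z_e,$$ converge absolutely for all $T\in\mathcal T$ and all $\lambda\in\mathbb C^E$ with $\Re\lambda_e>0$ for all $e$. Give each simple cycle $C$ an arbitrary orientation, and let $\epsilon_C(e)=\pm1$ according to whether $e\in C$ is directed along or against it; let $\epsilon_C(e,e')=\epsilon_C(e)\epsilon_C(e')$. For a simple path $\sigma$ from $x_0$ to $\delta$ let $\epsilon_\sigma(e)=\pm1$ according to whether $e\in\sigma$ is directed from $x_0$ towards $\delta$ along $\sigma$ or not. Put $l_C(\lambda)=\sum_{e\in C}\epsilon_C(e)\lambda_e$, $l_\sigma(\lambda)=\sum_{e\in\sigma}\epsilon_\sigma(e)\lambda_e$, and $M=\mathbb C^E\setminus\bigcup_C\ker l_C$. Let $(f_T)_{T\in\mathcal T}$ be the canonical basis of $\mathbb R^{\mathcal T}$. Let $\Omega_\sigma f_T=f_T$ if $\sigma\subset T$ and $\Omega_\sigma f_T=0$ otherwise. Let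 $$\Omega_C f_T=\sum_{e\in C}\epsilon_C(e_0,e)\,\alpha_e\,f_{T\cup\{e_0\}\setminus\{e\}}$$ if there is an edge $e_0\in T^c$ (necessarily unique and in $C$) with $C\subset T\cup\{e_0\}$, and $\Omega_C f_T=0$ otherwise. Identify an endomorphism $A$ of $\mathbb R^{\mathcal T}$ with the $\mathcal T\times\mathcal T$ matrix whose row of index $T$ consists of the coordinates of $A f_T$, i.e. $A f_T=\sum_{T'}A_{T,T'}f_{T'}$, and let it act on vectors by $(AI)_T=\sum_{T'}A_{T,T'}I_{T'}$. Then on $M\cap\{\lambda:\Re\lambda_e>0\ \text{for all } e\in E\}$ the vector $I_\Delta=(I_{\Delta,T})_{T\in\mathcal T}$ is complex differentiable in $\lambda$ and satisfies $$dI_\Delta(\lambda)=-\Omega\,I_\Delta(\lambda),\qquad \Omega=\sum_\sigma dl_\sigma\,\Omega_\sigma+\sum_C\frac{dl_C}{l_C(\lambda)}\,\Omega_C,$$ where $\sigma$ runs over the simple paths from $x_0$ to $\delta$ and $C$ over the simple cycles of $G$. -/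

import Mathlib

/-- A simple directed graph without loops whose edge set is a finite set of ordered pairs,
with a cemetery vertex `δ` and a base point `x₀`. The edge `(x, y)` has origin `x` and
destination `y`. The paths to and from the special vertices are required in `RootedGraph`. -/
structure PreGraph (V : Type*) where
  edges : Finset (V × V)
  δ : V
  x₀ : V
  x₀_ne_δ : x₀ ≠ δ
  no_loop : ∀ x, (x, x) ∉ edges
  no_edge_from_δ : ∀ y, (δ, y) ∉ edges

namespace PreGraph

variable {V : Type*} (G : PreGraph V)

/-- The type of edges. -/
abbrev Edge : Type _ := {e : V × V // e ∈ G.edges}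

noncomputable instance instDecidableEqEdge : DecidableEq G.Edge := Classical.decEq _

/-- `e = (x, y)` or `e = (y, x)`. -/
def Joins (e : G.Edge) (x y : V) : Prop := e.1 = (x, y) ∨ e.1 = (y, x)

/-- The list of distinct vertices `v 0 = x, …, v k = y` and the list of edges `e 0, …, e (k-1)`
exhibit `σ` as the edge set of a simple path from `x` to `y`. -/
structure IsPathList (x y : V) (σ : Finset G.Edge) {k : ℕ}
    (v : Fin (k + 1) → V) (e : Fin k → G.Edge) : Prop where
  inj : Function.Injective v
  start : v 0 = x
  finish : v (Fin.last k) = y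
  joins : ∀ j, G.Joins (e j) (v j.castSucc) (v j.succ)
  image_eq : σ = Finset.univ.image e

/-- `σ` is (the edge set of) a simple path from `x` to `y`, edges being used in any direction. -/
def IsSimplePath (x y : V) (σ : Finset G.Edge) : Prop :=
  ∃ (k : ℕ) (v : Fin (k + 1) → V) (e : Fin k → G.Edge), G.IsPathList x y σ v e

/-- `σ` is a directed simple path from `x` to `y`. -/
def IsDirectedPath (x y : V) (σ : Finset G.Edge) : Prop :=
  ∃ (k : ℕ) (v : Fin (k + 1) → V) (e : Fin k → G.Edge), G.IsPathList x y σ v e ∧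
    ∀ j, (e j).1 = (v j.castSucc, v j.succ)

open scoped Classical in
/-- For `e` in the simple path `σ` from `x` to `y`: `1` if `e` is traversed along its own direction
when going from `x` to `y`, and `-1` otherwise. -/
noncomputable def pathSign (x y : V) (σ : Finset G.Edge) (a : G.Edge) : ℤ :=
  if ∃ (k : ℕ) (v : Fin (k + 1) → V) (e : Fin k → G.Edge), G.IsPathList x y σ v e ∧
      ∃ j, e j = a ∧ a.1 = (v j.castSucc, v j.succ) then 1 else -1

/-- The distinct vertices `v 0, …, v k` and distinct edges `e 0, …, e k` exhibit `C` as the edge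
set of a simple cycle (`j + 1` is cyclic, so the last edge joins `v k` to `v 0`). -/
structure IsCycleList (C : Finset G.Edge) {k : ℕ}
    (v : Fin (k + 1) → V) (e : Fin (k + 1) → G.Edge) : Prop where
  inj_vertices : Function.Injective v
  inj_edges : Function.Injective e
  joins : ∀ j, G.Joins (e j) (v j) (v (j + 1))
  image_eq : C = Finset.univ.image e

/-- `C` is (the edge set of) a simple cycle, edges being used in any direction. -/
def IsCycle (C : Finset G.Edge) : Prop :=
  ∃ (k : ℕ) (v : Fin (k + 1) → V) (e : Fin (k + 1) → G.Edge), G.IsCycleList C v e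

open scoped Classical in
/-- `ε` is the sign function on `C` given by one of the orientations of the cycle `C`: `1` on edges
directed according to the orientation and `-1` on edges directed in opposition to it. -/
def IsCycleOrientation (C : Finset G.Edge) (ε : G.Edge → ℤ) : Prop :=
  ∃ (k : ℕ) (v : Fin (k + 1) → V) (e : Fin (k + 1) → G.Edge), G.IsCycleList C v e ∧
    ∀ j, ε (e j) = if (e j).1 = (v j, v (j + 1)) then 1 else -1

/-- A spanning tree: no cycle, and a simple path between any two vertices. -/
def IsSpanningTree (T : Finset G.Edge) : Prop :=
  (∀ C, G.IsCycle C → ¬ C ⊆ T) ∧ ∀ x y : V, x ≠ y → ∃ σ, G.IsSimplePath x y σ ∧ σ ⊆ T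

/-- The set of spanning trees. -/
abbrev SpanningTree : Type _ := {T : Finset G.Edge // G.IsSpanningTree T}

noncomputable instance instFintypeSpanningTree : Fintype G.SpanningTree := Fintype.ofFinite _

noncomputable instance instDecidableEqSpanningTree : DecidableEq G.SpanningTree := Classical.decEq _

open scoped Classical in
/-- The divergence `div θ (x) = ∑_{e from x} θ_e - ∑_{e to x} θ_e`. -/
noncomputable def div (θ : G.Edge → ℝ) (x : V) : ℝ :=
  ∑ e : G.Edge with e.1.1 = x, θ e - ∑ e : G.Edge with e.1.2 = x, θ e

open scoped Classical in
/-- The affine space of all `z` with `div z = δ_{x₀}` on `U = V \ {δ}`. -/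
def affineSpace : Set (G.Edge → ℝ) :=
  {z | ∀ x, x ≠ G.δ → G.div z x = if x = G.x₀ then 1 else 0}

/-- The chamber `Δ` of the affine space on which all `z_e` are positive. -/
def chamber : Set G.affineSpace := {z | ∀ e, 0 < z.1 e}

/-- The measure `|dz_{e₁} ∧ ⋯ ∧ dz_{e_n}|` on the affine space, where `{e₁, …, e_n}` is the complement
of the spanning tree `T`: Lebesgue measure read in the coordinates `(z_e)_{e ∉ T}`, which
are global affine coordinates of the affine space. -/
noncomputable def coordVolume (T : Finset G.Edge) : MeasureTheory.Measure G.affineSpace :=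
  MeasureTheory.Measure.comap
    (fun (z : G.affineSpace) (e : {e : G.Edge // e ∉ T}) => z.1 e.1) MeasureTheory.volume

/-- The density with respect to `coordVolume T` of
`exp (-⟨λ, z⟩) ∏_e z_e ^ α_e ω_T`, where `ω_T = ∧_{e ∉ T} dz_e / z_e`. -/
noncomputable def integrand (α : G.Edge → ℝ) (T : Finset G.Edge) (l : G.Edge → ℂ)
    (z : G.affineSpace) : ℂ :=
  Complex.exp (-∑ e, l e * (z.1 e : ℂ)) *
    (((∏ e, (z.1 e) ^ (α e)) * ∏ e ∈ Tᶜ, (z.1 e)⁻¹ : ℝ) : ℂ)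

/-- The domain `{Re λ_e > 0 for all e}`. -/
def rightDomain : Set (G.Edge → ℂ) := {l | ∀ e, 0 < (l e).re}

/-- The integrals `I_{Δ,T}(λ)` are well-defined (absolutely convergent), for all spanning trees `T`
and all `λ` with positive real parts. -/
def IntegralsWellDefined (α : G.Edge → ℝ) : Prop :=
  ∀ T : G.SpanningTree, ∀ l ∈ G.rightDomain,
    MeasureTheory.IntegrableOn (G.integrand α T.1 l) G.chamber (G.coordVolume T.1)

/-- The vector `I_Δ(λ) = (I_{Δ,T}(λ))_T`. -/
noncomputable def hyperInt (α : G.Edge → ℝ) (l : G.Edge → ℂ) : G.SpanningTree → ℂ :=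
  fun T => ∫ z in G.chamber, G.integrand α T.1 l z ∂(G.coordVolume T.1)

/-- The linear form `λ ↦ ∑_{e ∈ S} ε(e) λ_e`. -/
noncomputable def linForm (S : Finset G.Edge) (ε : G.Edge → ℤ) : (G.Edge → ℂ) →ₗ[ℂ] ℂ :=
  ∑ e ∈ S, (ε e : ℂ) • LinearMap.proj e

/-- The complement `M` of the hyperplanes `ker l_C`, `C` a cycle; `ε C` is the chosen orientation
of `C`. -/
def M (ε : Finset G.Edge → G.Edge → ℤ) : Set (G.Edge → ℂ) :=
  {l | ∀ C, G.IsCycle C → l ∉ LinearMap.ker (G.linForm C (ε C))}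

open scoped Classical in
/-- The canonical basis vector `f_S` of `ℝ^𝒯`, for `S` a spanning tree. -/
noncomputable def treeVec (S : Finset G.Edge) : G.SpanningTree → ℝ :=
  fun T => if T.1 = S then 1 else 0

open scoped Classical in
/-- The endomorphism `Ω_σ`: `f_T ↦ f_T` if `σ ⊆ T`, and `f_T ↦ 0` otherwise. -/
noncomputable def OmegaPath (σ : Finset G.Edge) :
    (G.SpanningTree → ℝ) →ₗ[ℝ] (G.SpanningTree → ℝ) :=
  (Pi.basisFun ℝ G.SpanningTree).constr ℝ fun T => if σ ⊆ T.1 then G.treeVec T.1 else 0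

open scoped Classical in
/-- The endomorphism `Ω_C`: `f_T ↦ ∑_{e ∈ C} ε_C(e₀, e) α_e f_{T ∪ {e₀} \ {e}}` if there is `e₀ ∉ T`
with `C ⊆ T ∪ {e₀}`, and `f_T ↦ 0` otherwise. Such an `e₀` is unique (it is the only element of
`C` outside `T`), so the outer sum has at most one term;
`ε_C(e₀, e) = ε_C(e₀) ε_C(e)` compares the directions of `e₀` and `e` in `C`. -/
noncomputable def OmegaCycle (α : G.Edge → ℝ) (C : Finset G.Edge) (ε : G.Edge → ℤ) :
    (G.SpanningTree → ℝ) →ₗ[ℝ] (G.SpanningTree → ℝ) :=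
  (Pi.basisFun ℝ G.SpanningTree).constr ℝ fun T =>
    ∑ e₀ : G.Edge with e₀ ∉ T.1 ∧ C ⊆ insert e₀ T.1,
      ∑ e ∈ C, (((ε e₀ * ε e : ℤ) : ℝ) * α e) • G.treeVec ((insert e₀ T.1).erase e)

/-- The `𝒯 × 𝒯` matrix of an endomorphism `A` of `ℝ^𝒯` whose row of index `T` holds the coordinates
of `A f_T`. -/
noncomputable def rowMatrix (A : (G.SpanningTree → ℝ) →ₗ[ℝ] (G.SpanningTree → ℝ)) :
    Matrix G.SpanningTree G.SpanningTree ℂ :=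
  Matrix.of fun T T' => ((A (Pi.single T 1) T' : ℝ) : ℂ)

open scoped Classical in
/-- The matrix-valued differential form
`Ω = ∑_σ dl_σ Ω_σ + ∑_C (dl_C / l_C) Ω_C` at the point `λ = l`, a linear function of the
tangent vector. The sums run over the simple paths `σ` from `x₀` to `δ` and over the cycles `C`. -/
noncomputable def Omega (α : G.Edge → ℝ) (ε : Finset G.Edge → G.Edge → ℤ) (l : G.Edge → ℂ) :
    (G.Edge → ℂ) →ₗ[ℂ] Matrix G.SpanningTree G.SpanningTree ℂ :=
  ∑ σ : Finset G.Edge with G.IsSimplePath G.x₀ G.δ σ,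
      (G.linForm σ (G.pathSign G.x₀ G.δ σ)).smulRight (G.rowMatrix (G.OmegaPath σ)) +
    ∑ C : Finset G.Edge with G.IsCycle C,
      ((G.linForm C (ε C) l)⁻¹ • G.linForm C (ε C)).smulRight
        (G.rowMatrix (G.OmegaCycle α C (ε C)))

end PreGraph

/-- A graph with cemetery `δ` and base point `x₀` such that every vertex `x ≠ δ` is joined to `δ`,
and `x₀` to every other vertex `x ≠ δ`, by a directed simple path. -/
structure RootedGraph (V : Type*) extends PreGraph V where
  path_to_δ : ∀ x, x ≠ δ → ∃ σ, toPreGraph.IsDirectedPath x δ σ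
  path_from_x₀ : ∀ x, x ≠ δ → x ≠ x₀ → ∃ σ, toPreGraph.IsDirectedPath x₀ x σ

/-!
Differentiating under the integral sign produces the moments `∫ z_a e^{-⟨l, z⟩} ∏ z_e ^ α_e ω_T`.
A point of the affine space is the unit flow along the path from `x₀` to `δ` in `T` plus the sum,
over the edges `i ∉ T`, of `z_i` times the circulation along the fundamental cycle `C_i`. The path
gives the terms `dl_σ Ω_σ`, and it remains to compute the moments of the coordinates `z_i`. The
derivative of `z_i e^{-⟨l, z⟩} ∏ z_e ^ α_e ∏_{e ∉ T} z_e⁻¹` along `C_i` has integral zero. It does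
not differentiate the factors `z_e⁻¹` with `e ∉ T`, `e ≠ i`, since these are constant along `C_i`,
and this yields

`l_{C_i}(l) ∫ z_i e^{-⟨l, z⟩} ∏ z_e ^ α_e ω_T = ∑_{e ∈ C_i} ± α_e I_{Δ, T ∪ {i} ∖ {e}}(l)`

because exchanging `i` for `e ∈ C_i` changes a coordinate by an affine map with coefficient `±1` and
so does not change the volume. The boundary terms vanish because the quotients of the function by
the `z_e`, `e ∈ C_i`, are again integrands, hence integrable.
-/

open MeasureTheory Filter Topology

lemma mul_exp_neg_sum_le {ι : Type*} [Fintype ι] {m r z : ι → ℝ} (hm : ∀ i, 0 < m i)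
    (hr : ∀ i, 2 * m i ≤ r i) (hz : ∀ i, 0 ≤ z i) (i : ι) :
    z i * Real.exp (-∑ j, r j * z j) ≤ (m i)⁻¹ * Real.exp (-∑ j, m j * z j) := by
  set s := ∑ j, m j * z j
  have le_exp : m i * z i ≤ Real.exp s :=
    calc m i * z i ≤ s := Finset.single_le_sum (f := fun j => m j * z j)
          (fun j _ => mul_nonneg (hm j).le (hz j)) (Finset.mem_univ i)
      _ ≤ Real.exp s := (lt_add_one s).le.trans (Real.add_one_le_exp s)
  have two_mul_le : 2 * s ≤ ∑ j, r j * z j := by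
    rw [Finset.mul_sum]
    exact Finset.sum_le_sum fun j _ => by
      rw [← mul_assoc]
      exact mul_le_mul_of_nonneg_right (hr j) (hz j)
  rw [inv_mul_eq_div, le_div_iff₀' (hm i)]
  calc m i * (z i * Real.exp (-∑ j, r j * z j))
      = m i * z i * Real.exp (-∑ j, r j * z j) := (mul_assoc _ _ _).symm
    _ ≤ Real.exp s * Real.exp (-(2 * s)) := by gcongr
    _ = Real.exp (-s) := by rw [← Real.exp_add]; ring_nf

/-! ### Integration by parts on polyhedra -/

lemma measurePreserving_update_affineMap {ι : Type*} [Fintype ι] [DecidableEq ι] {i : ι}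
    (L : (ι → ℝ) →ᵃ[ℝ] ℝ) (hL : |L.linear (Pi.single i 1)| = 1) :
    MeasurePreserving fun y : ι → ℝ => Function.update y i (L y) := by
  let A : Matrix ι ι ℝ := (1 : Matrix ι ι ℝ).updateRow i fun j => L.linear (Pi.single j 1)
  have det_A : A.det = L.linear (Pi.single i 1) := by
    rw [← Matrix.cramer_transpose_apply, Matrix.transpose_one, Matrix.cramer_one,
      Module.End.one_apply]
  have preserves_A : MeasurePreserving (Matrix.toLin' A) := by
    refine ⟨(LinearMap.continuous_of_finiteDimensional _).measurable, ?_⟩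
    rw [Real.map_matrix_volume_pi_eq_smul_volume_pi, det_A, abs_inv, hL]
    · simp
    · rw [det_A]
      exact abs_ne_zero.1 (by rw [hL]; exact one_ne_zero)
  have update_eq : (fun y : ι → ℝ => Function.update y i (L y)) =
      (fun y => y + Pi.single i (L 0)) ∘ Matrix.toLin' A := by
    ext y j
    by_cases hj : j = i
    · subst hj
      have L_eq : L.linear y = ∑ k, L.linear (Pi.single k 1) * y k := by
        conv_lhs => rw [pi_eq_sum_univ' y, map_sum]
        simp [mul_comm]
      simp [A, Matrix.updateRow_mulVec, dotProduct, ← L_eq, congrFun L.decomp y]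
    · simp [A, Matrix.updateRow_mulVec, hj]
  rw [update_eq]
  exact (measurePreserving_add_right volume _).comp preserves_A

lemma hasLineDerivAt_comp_affineMap {E E' F : Type*} [AddCommGroup E] [Module ℝ E]
    [AddCommGroup E'] [Module ℝ E'] [NormedAddCommGroup F] [NormedSpace ℝ F] {f : E' → F} {f' : F}
    (A : E →ᵃ[ℝ] E') {x v : E} (hf : HasLineDerivAt ℝ f f' (A x) (A.linear v)) :
    HasLineDerivAt ℝ (f ∘ A) f' x v := by
  have affine_line (t : ℝ) : A (x + t • v) = A x + t • A.linear v := by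
    rw [add_comm, ← vadd_eq_add, A.map_vadd, map_smul, vadd_eq_add, add_comm]
  simpa only [HasLineDerivAt, Function.comp_apply, affine_line] using hf

/-- The open polyhedron cut out by a family of strict affine inequalities. -/
def openPolyhedron {ι E : Type*} [AddCommGroup E] [Module ℝ E] (L : ι → E →ᵃ[ℝ] ℝ) : Set E :=
  {x | ∀ i, 0 < L i x}

lemma isOpen_openPolyhedron {ι E : Type*} [Finite ι] [NormedAddCommGroup E] [NormedSpace ℝ E]
    [FiniteDimensional ℝ E] (L : ι → E →ᵃ[ℝ] ℝ) : IsOpen (openPolyhedron L) := by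
  simp only [openPolyhedron, Set.ofPred_forall]
  exact isOpen_iInter_of_finite fun i =>
    isOpen_lt continuous_const (L i).continuous_of_finiteDimensional

namespace openPolyhedron

/-- A function on the open polyhedron which tends to infinity at its boundary. -/
noncomputable def barrier {ι E : Type*} [Fintype ι] [AddCommGroup E] [Module ℝ E]
    (L : ι → E →ᵃ[ℝ] ℝ) (x : E) : ℝ :=
  ∑ i, (L i x)⁻¹

/-- A smooth function on the line, equal to `1` on `[-1, 1]` and supported in `[-2, 2]`. -/
noncomputable def bump : ContDiffBump (0 : ℝ) := ⟨1, 2, one_pos, one_lt_two⟩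

lemma continuous_deriv_bump : Continuous (deriv bump) :=
  bump.contDiff.continuous_deriv (n := 1) le_rfl

lemma exists_bound_mul_deriv_bump : ∃ B : ℝ, ∀ t, |t * deriv bump t| ≤ B :=
  (continuous_id.mul continuous_deriv_bump).bounded_above_of_compact_support
    bump.hasCompactSupport.deriv.mul_left

lemma bump_eventuallyEq_one {t : ℝ} (ht : |t| < 1) : bump =ᶠ[𝓝 t] 1 :=
  bump.eventuallyEq_one_of_mem_ball (by simpa [bump] using ht)

lemma bump_eq_zero {t : ℝ} (ht : 2 ≤ t) : bump t = 0 :=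
  bump.zero_of_le_dist (by simpa [bump] using ht.trans (le_abs_self t))

variable {ι E F : Type*} [Fintype ι] [NormedAddCommGroup E] [NormedSpace ℝ E]
  [NormedAddCommGroup F] [NormedSpace ℝ F] {L : ι → E →ᵃ[ℝ] ℝ} {r : ℝ} {x v : E}
  {f f' : E → F}

variable (L r) in
/-- A cutoff function on the open polyhedron: it vanishes near the boundary, and tends to `1` as `r`
tends to `0`. -/
noncomputable def cutoff (x : E) : ℝ := bump (r * barrier L x)

variable (L r v) in
/-- The derivative of `cutoff L r` in the direction `v`. -/
noncomputable def cutoffDeriv (x : E) : ℝ :=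
  deriv bump (r * barrier L x) * (r * ∑ i, -(L i).linear v / L i x ^ 2)

lemma hasLineDerivAt_affineMap (A : E →ᵃ[ℝ] ℝ) (x v : E) :
    HasLineDerivAt ℝ A (A.linear v) x v := by
  have hid : HasLineDerivAt ℝ (id : ℝ → ℝ) (A.linear v) (A x) (A.linear v) := by
    simpa using (hasFDerivAt_id (𝕜 := ℝ) (A x)).hasLineDerivAt (A.linear v)
  exact hasLineDerivAt_comp_affineMap A hid

lemma hasLineDerivAt_cutoff (hx : x ∈ openPolyhedron L) :
    HasLineDerivAt ℝ (cutoff L r) (cutoffDeriv L r v x) x v := by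
  have inner : HasDerivAt (fun t : ℝ => r * barrier L (x + t • v))
      (r * ∑ i, -(L i).linear v / L i x ^ 2) 0 := by
    refine HasDerivAt.const_mul r (HasDerivAt.fun_sum fun i _ => ?_)
    simpa using HasDerivAt.fun_inv (hasLineDerivAt_affineMap (L i) x v) (by simpa using (hx i).ne')
  have outer := (bump.contDiff (n := 1)).differentiable one_ne_zero (r * barrier L x) |>.hasDerivAt
  exact HasDerivAt.comp_of_eq 0 outer inner (by simp)

lemma cutoff_mem_Icc (x : E) : cutoff L r x ∈ Set.Icc 0 1 :=
  ⟨bump.nonneg, bump.le_one⟩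

lemma inv_le_barrier (hx : x ∈ openPolyhedron L) (i : ι) : (L i x)⁻¹ ≤ barrier L x :=
  Finset.single_le_sum (f := fun i => (L i x)⁻¹) (fun j _ => (inv_pos.2 (hx j)).le)
    (Finset.mem_univ i)

/-- The factor `(L i x)⁻¹ ^ 2` is at most `(L i x)⁻¹ * barrier L x`, and the barrier is absorbed by
the boundedness of `t * deriv bump t`. -/
lemma abs_cutoffDeriv_le {B : ℝ} (hB : ∀ t, |t * deriv bump t| ≤ B) (hr : 0 < r)
    (hx : x ∈ openPolyhedron L) :
    |cutoffDeriv L r v x| ≤ B * ∑ i, |(L i).linear v| * (L i x)⁻¹ := by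
  have abs_sum_le : |∑ i, -(L i).linear v / L i x ^ 2| ≤
      barrier L x * ∑ i, |(L i).linear v| * (L i x)⁻¹ := by
    rw [Finset.mul_sum]
    refine (Finset.abs_sum_le_sum_abs _ _).trans (Finset.sum_le_sum fun i _ => ?_)
    calc |-(L i).linear v / L i x ^ 2| = (L i x)⁻¹ * (|(L i).linear v| * (L i x)⁻¹) := by
          rw [abs_div, abs_neg, abs_of_pos (pow_pos (hx i) 2)]
          have := (hx i).ne'
          field_simp
      _ ≤ barrier L x * (|(L i).linear v| * (L i x)⁻¹) :=
          mul_le_mul_of_nonneg_right (inv_le_barrier hx i)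
            (mul_nonneg (abs_nonneg _) (inv_pos.2 (hx i)).le)
  have sum_nonneg : 0 ≤ ∑ i, |(L i).linear v| * (L i x)⁻¹ :=
    Finset.sum_nonneg fun i _ => mul_nonneg (abs_nonneg _) (inv_pos.2 (hx i)).le
  have barrier_nonneg : 0 ≤ barrier L x := Finset.sum_nonneg fun i _ => (inv_pos.2 (hx i)).le
  calc |cutoffDeriv L r v x|
      = |deriv bump (r * barrier L x)| * (r * |∑ i, -(L i).linear v / L i x ^ 2|) := by
        rw [cutoffDeriv, abs_mul, abs_mul, abs_of_pos hr]
    _ ≤ |deriv bump (r * barrier L x)| *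
          (r * (barrier L x * ∑ i, |(L i).linear v| * (L i x)⁻¹)) := by gcongr
    _ = |r * barrier L x * deriv bump (r * barrier L x)| *
          ∑ i, |(L i).linear v| * (L i x)⁻¹ := by
        rw [abs_mul, abs_mul, abs_of_pos hr, abs_of_nonneg barrier_nonneg]
        ring
    _ ≤ B * ∑ i, |(L i).linear v| * (L i x)⁻¹ := by gcongr; exact hB _

lemma eventually_cutoff_eq (x v : E) :
    ∀ᶠ r in 𝓝[>] 0, cutoff L r x = 1 ∧ cutoffDeriv L r v x = 0 := by
  have tendsto_zero : Tendsto (fun r => |r * barrier L x|) (𝓝[>] 0) (𝓝 0) :=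
    tendsto_nhdsWithin_of_tendsto_nhds (Continuous.tendsto' (by fun_prop) _ _ (by simp))
  filter_upwards [tendsto_zero.eventually_lt_const one_pos] with r hr
  have bump_eq := bump_eventuallyEq_one hr
  refine ⟨bump_eq.eq_of_nhds, ?_⟩
  rw [cutoffDeriv, bump_eq.deriv_eq]
  simp

lemma norm_deriv_cutoff_smul_le {B : ℝ} (hB : ∀ t, |t * deriv bump t| ≤ B) (hr : 0 < r)
    (hx : x ∈ openPolyhedron L) :
    ‖cutoff L r x • f' x + cutoffDeriv L r v x • f x‖ ≤
      ‖f' x‖ + B * ∑ i, |(L i).linear v| * ‖(L i x)⁻¹ • f x‖ := by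
  refine (norm_add_le _ _).trans (add_le_add ?_ ?_)
  · rw [norm_smul, Real.norm_of_nonneg (cutoff_mem_Icc x).1]
    exact mul_le_of_le_one_left (norm_nonneg _) (cutoff_mem_Icc x).2
  · rw [norm_smul, Real.norm_eq_abs]
    refine (mul_le_mul_of_nonneg_right (abs_cutoffDeriv_le hB hr hx) (norm_nonneg _)).trans_eq ?_
    rw [mul_assoc, Finset.sum_mul]
    simp only [norm_smul, norm_inv, Real.norm_of_nonneg (hx _).le, mul_assoc]

lemma integrableOn_bound [MeasurableSpace E] {μ : Measure E}
    (hf' : IntegrableOn f' (openPolyhedron L) μ)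
    (hfL : ∀ i, (L i).linear v ≠ 0 → IntegrableOn (fun x => (L i x)⁻¹ • f x) (openPolyhedron L) μ)
    (B : ℝ) : IntegrableOn
      (fun x => ‖f' x‖ + B * ∑ i, |(L i).linear v| * ‖(L i x)⁻¹ • f x‖) (openPolyhedron L) μ := by
  refine hf'.norm.add (Integrable.const_mul (integrable_finsetSum _ fun i _ => ?_) B)
  by_cases hi : (L i).linear v = 0
  · simp [hi]
  · exact (hfL i hi).norm.const_mul _

variable [FiniteDimensional ℝ E]

lemma cutoff_eventually_eq_zero (hr : 0 < r) (hx : x ∉ openPolyhedron L) :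
    ∀ᶠ y in 𝓝 x, y ∈ openPolyhedron L → cutoff L r y = 0 := by
  obtain ⟨i, hi⟩ : ∃ i, L i x ≤ 0 := by simpa [openPolyhedron] using hx
  have small : ∀ᶠ y in 𝓝 x, L i y < r / 2 :=
    (L i).continuous_of_finiteDimensional.continuousAt.eventually_lt_const
      (hi.trans_lt (half_pos hr))
  filter_upwards [small] with y hy hyP
  refine bump_eq_zero ?_
  calc 2 = r * (r / 2)⁻¹ := by field_simp
    _ ≤ r * (L i y)⁻¹ := by gcongr; exact hyP i
    _ ≤ r * barrier L y := by gcongr; exact inv_le_barrier hyP i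

lemma hasLineDerivAt_indicator_cutoff_smul (hr : 0 < r)
    (hf : ∀ x ∈ openPolyhedron L, HasLineDerivAt ℝ f (f' x) x v) (x : E) :
    HasLineDerivAt ℝ ((openPolyhedron L).indicator fun x => cutoff L r x • f x)
      ((openPolyhedron L).indicator
        (fun x => cutoff L r x • f' x + cutoffDeriv L r v x • f x) x) x v := by
  by_cases hx : x ∈ openPolyhedron L
  · rw [Set.indicator_of_mem hx]
    have product : HasLineDerivAt ℝ (fun x => cutoff L r x • f x)
        (cutoff L r x • f' x + cutoffDeriv L r v x • f x) x v := by
      simpa [HasLineDerivAt] using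
        HasDerivAt.fun_smul (hasLineDerivAt_cutoff (r := r) (v := v) hx) (hf x hx)
    refine product.congr_of_eventuallyEq ?_
    filter_upwards [(isOpen_openPolyhedron L).mem_nhds hx] with y hy
    exact Set.indicator_of_mem hy _
  · rw [Set.indicator_of_notMem hx]
    have hzero : HasLineDerivAt ℝ (fun _ : E => (0 : F)) 0 x v := hasDerivAt_const _ _
    refine hzero.congr_of_eventuallyEq ?_
    filter_upwards [cutoff_eventually_eq_zero hr hx] with y hy
    by_cases hyP : y ∈ openPolyhedron L
    · rw [Set.indicator_of_mem hyP, hy hyP, zero_smul]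
    · exact Set.indicator_of_notMem hyP _

variable [MeasurableSpace E] [BorelSpace E] {μ : Measure E}

lemma measurable_affineMap (A : E →ᵃ[ℝ] ℝ) : Measurable A :=
  A.continuous_of_finiteDimensional.measurable

lemma measurable_cutoff : Measurable (cutoff L r) := by
  have hL (i) := measurable_affineMap (L i)
  have _ : Measurable bump := bump.continuous.measurable
  unfold cutoff barrier
  fun_prop

lemma measurable_cutoffDeriv : Measurable (cutoffDeriv L r v) := by
  have hL (i) := measurable_affineMap (L i)
  have _ : Measurable (deriv bump) := continuous_deriv_bump.measurable
  unfold cutoffDeriv barrier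
  fun_prop

lemma integrableOn_deriv_cutoff_smul (hr : 0 < r) (hf : IntegrableOn f (openPolyhedron L) μ)
    (hf' : IntegrableOn f' (openPolyhedron L) μ)
    (hfL : ∀ i, (L i).linear v ≠ 0 →
      IntegrableOn (fun x => (L i x)⁻¹ • f x) (openPolyhedron L) μ) :
    IntegrableOn (fun x => cutoff L r x • f' x + cutoffDeriv L r v x • f x)
      (openPolyhedron L) μ := by
  obtain ⟨B, hB⟩ := exists_bound_mul_deriv_bump
  refine (integrableOn_bound hf' hfL B).mono' ?_ ?_
  · exact (measurable_cutoff.aestronglyMeasurable.smul hf'.aestronglyMeasurable).add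
      (measurable_cutoffDeriv.aestronglyMeasurable.smul hf.aestronglyMeasurable)
  · exact ae_restrict_of_forall_mem (isOpen_openPolyhedron L).measurableSet fun x hx =>
      norm_deriv_cutoff_smul_le hB hr hx

lemma integral_deriv_cutoff_smul_eq_zero [μ.IsAddHaarMeasure] (hr : 0 < r)
    (hderiv : ∀ x ∈ openPolyhedron L, HasLineDerivAt ℝ f (f' x) x v)
    (hf : IntegrableOn f (openPolyhedron L) μ) (hf' : IntegrableOn f' (openPolyhedron L) μ)
    (hfL : ∀ i, (L i).linear v ≠ 0 →
      IntegrableOn (fun x => (L i x)⁻¹ • f x) (openPolyhedron L) μ) :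
    ∫ x in openPolyhedron L, (cutoff L r x • f' x + cutoffDeriv L r v x • f x) ∂μ = 0 := by
  have measurableSet := (isOpen_openPolyhedron L).measurableSet
  have integrable_cutoff_smul : IntegrableOn (fun x => cutoff L r x • f x) (openPolyhedron L) μ :=
    hf.bdd_smul 1 measurable_cutoff.aestronglyMeasurable (ae_of_all _ fun x => by
      rw [Real.norm_of_nonneg (cutoff_mem_Icc x).1]
      exact (cutoff_mem_Icc x).2)
  have by_parts := integral_bilinear_hasLineDerivAt_right_eq_neg_left_of_integrable
    (μ := μ) (v := v) (f := fun _ => (1 : ℝ)) (f' := fun _ => 0)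
    (B := ContinuousLinearMap.lsmul ℝ ℝ) (by simp)
    (by simpa using
      (integrableOn_deriv_cutoff_smul hr hf hf' hfL).integrable_indicator measurableSet)
    (by simpa using integrable_cutoff_smul.integrable_indicator measurableSet)
    (fun x _ => hasDerivAt_const 0 1)
    (fun x _ => hasLineDerivAt_indicator_cutoff_smul hr hderiv x)
  simpa [integral_indicator measurableSet] using by_parts

omit [Fintype ι] in
theorem integral_lineDeriv_eq_zero [Finite ι] [μ.IsAddHaarMeasure]
    (hderiv : ∀ x ∈ openPolyhedron L, HasLineDerivAt ℝ f (f' x) x v)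
    (hf : IntegrableOn f (openPolyhedron L) μ) (hf' : IntegrableOn f' (openPolyhedron L) μ)
    (hfL : ∀ i, (L i).linear v ≠ 0 →
      IntegrableOn (fun x => (L i x)⁻¹ • f x) (openPolyhedron L) μ) :
    ∫ x in openPolyhedron L, f' x ∂μ = 0 := by
  cases nonempty_fintype ι
  have measurableSet := (isOpen_openPolyhedron L).measurableSet
  obtain ⟨B, hB⟩ := exists_bound_mul_deriv_bump
  have tendsto_integral : Tendsto
      (fun r => ∫ x in openPolyhedron L, (cutoff L r x • f' x + cutoffDeriv L r v x • f x) ∂μ)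
      (𝓝[>] 0) (𝓝 (∫ x in openPolyhedron L, f' x ∂μ)) := by
    refine tendsto_integral_filter_of_dominated_convergence _ ?_ ?_
      (integrableOn_bound hf' hfL B) ?_
    · filter_upwards [self_mem_nhdsWithin] with r hr
      exact (integrableOn_deriv_cutoff_smul hr hf hf' hfL).aestronglyMeasurable
    · filter_upwards [self_mem_nhdsWithin] with r hr
      exact ae_restrict_of_forall_mem measurableSet fun x hx =>
        norm_deriv_cutoff_smul_le hB hr hx
    · refine ae_of_all _ fun x => tendsto_const_nhds.congr' ?_
      filter_upwards [eventually_cutoff_eq (L := L) x v] with r hr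
      rw [hr.1, hr.2, one_smul, zero_smul, add_zero]
  refine tendsto_nhds_unique tendsto_integral (tendsto_const_nhds.congr' ?_)
  filter_upwards [self_mem_nhdsWithin] with r hr
  exact (integral_deriv_cutoff_smul_eq_zero hr hderiv hf hf' hfL).symm

end openPolyhedron

namespace PreGraph

variable {V : Type*} {G : PreGraph V}

/-! ### Connectivity -/

lemma ends_ne (e : G.Edge) : e.1.1 ≠ e.1.2 := fun h => G.no_loop e.1.1 <| by
  have he : e.1 = (e.1.1, e.1.1) := Prod.ext rfl h.symm
  exact he ▸ e.2

lemma joins_ends (e : G.Edge) : G.Joins e e.1.1 e.1.2 := Or.inl rfl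

/-- The undirected graph whose edges are the elements of `S` with their direction forgotten. -/
def undirected (S : Finset G.Edge) : SimpleGraph V where
  Adj x y := ∃ e ∈ S, G.Joins e x y
  symm := ⟨fun _ _ ⟨e, he, h⟩ => ⟨e, he, h.symm⟩⟩
  loopless := ⟨fun x ⟨e, _, h⟩ => G.no_loop x <| by
    have he : e.1 = (x, x) := h.elim id id
    exact he ▸ e.2⟩

lemma undirected_adj {S : Finset G.Edge} {e : G.Edge} (he : e ∈ S) :
    (undirected S).Adj e.1.1 e.1.2 :=
  ⟨e, he, joins_ends e⟩

lemma exists_isSimplePath_of_reachable {S : Finset G.Edge} {x y : V}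
    (h : (undirected S).Reachable x y) : ∃ σ, G.IsSimplePath x y σ ∧ σ ⊆ S := by
  obtain ⟨p, hp⟩ := h.exists_isPath
  have hadj (j : Fin p.length) := p.adj_getVert_succ j.2
  choose e heS hej using hadj
  refine ⟨Finset.univ.image e, ⟨p.length, fun i => p.getVert i, e, ?_⟩, ?_⟩
  · refine ⟨fun i j hij => ?_, by simp, by simp, fun j => by simpa using hej j, rfl⟩
    exact Fin.ext (hp.getVert_injOn (by simpa using i.is_le) (by simpa using j.is_le) hij)
  · simpa [Finset.image_subset_iff] using heS

lemma IsPathList.mem {x y : V} {σ : Finset G.Edge} {k : ℕ} {v : Fin (k + 1) → V}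
    {e : Fin k → G.Edge} (h : G.IsPathList x y σ v e) (j : Fin k) : e j ∈ σ :=
  h.image_eq ▸ Finset.mem_image_of_mem e (Finset.mem_univ j)

lemma IsPathList.reachable {x y : V} {σ S : Finset G.Edge} {k : ℕ} {v : Fin (k + 1) → V}
    {e : Fin k → G.Edge} (h : G.IsPathList x y σ v e) (hS : σ ⊆ S) :
    (undirected S).Reachable x y := by
  have reachable_v : ∀ j, (undirected S).Reachable x (v j) := by
    intro j
    induction j using Fin.induction with
    | zero => rw [h.start]
    | succ i ih => exact ih.trans (SimpleGraph.Adj.reachable ⟨e i, hS (h.mem i), h.joins i⟩)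
  exact h.finish ▸ reachable_v (Fin.last k)

lemma isSpanningTree_iff {T : Finset G.Edge} : G.IsSpanningTree T ↔
    (∀ C, G.IsCycle C → ¬ C ⊆ T) ∧ (undirected T).Preconnected := by
  refine and_congr_right fun _ => ⟨fun h x y => ?_, fun h x y _ =>
    exists_isSimplePath_of_reachable (h x y)⟩
  by_cases hxy : x = y
  · rw [hxy]
  · obtain ⟨σ, ⟨k, v, e, hp⟩, hσ⟩ := h x y hxy
    exact hp.reachable hσ

lemma IsPathList.injective_edges {x y : V} {σ : Finset G.Edge} {k : ℕ} {v : Fin (k + 1) → V}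
    {e : Fin k → G.Edge} (h : G.IsPathList x y σ v e) : Function.Injective e := by
  intro i j hij
  have hi := h.joins i
  have hj := h.joins j
  rw [hij] at hi
  have hv : ∀ {p q}, v p = v q ↔ p = q := h.inj.eq_iff
  rcases hi with hi | hi <;> rcases hj with hj | hj <;> rw [hi, Prod.mk.injEq] at hj <;>
    simp only [hv, Fin.ext_iff, Fin.val_castSucc, Fin.val_succ] at hj <;> ext <;> omega

lemma IsSimplePath.isCycle_insert {a : G.Edge} {σ : Finset G.Edge}
    (h : G.IsSimplePath a.1.2 a.1.1 σ) (ha : a ∉ σ) : G.IsCycle (insert a σ) := by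
  obtain ⟨k, v, e, h⟩ := h
  refine ⟨k, v, Fin.snoc e a, h.inj, ?_, ?_, ?_⟩
  · refine Fin.snoc_injective_iff.2 ⟨h.injective_edges, ?_⟩
    rintro ⟨j, rfl⟩
    exact ha (h.mem j)
  · intro j
    refine Fin.lastCases ?_ (fun i => ?_) j
    · simpa only [Fin.snoc_last, Fin.last_add_one, h.start, h.finish] using joins_ends a
    · simpa using h.joins i
  · ext b
    simp only [h.image_eq, Finset.mem_insert, Finset.mem_image, Finset.mem_univ, true_and,
      Fin.exists_fin_succ', Fin.snoc_castSucc, Fin.snoc_last]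
    rw [or_comm, eq_comm (a := b)]

lemma IsSpanningTree.not_reachable_erase {T : Finset G.Edge} (hT : G.IsSpanningTree T)
    {e : G.Edge} (he : e ∈ T) : ¬ (undirected (T.erase e)).Reachable e.1.1 e.1.2 := by
  intro h
  obtain ⟨σ, hσ, hσT⟩ := exists_isSimplePath_of_reachable h.symm
  exact hT.1 _ (hσ.isCycle_insert fun he' => Finset.notMem_erase e T (hσT he'))
    (Finset.insert_subset he (hσT.trans (Finset.erase_subset _ _)))

/-! ### Boundaries and circulations -/

variable (G) in
/-- The boundary of a real 1-chain, with the origin of an edge counted positively: its value at `x`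
is the divergence `div θ x`. -/
noncomputable def boundary : (G.Edge → ℝ) →ₗ[ℝ] V →₀ ℝ :=
  Fintype.linearCombination ℝ fun e => Finsupp.single e.1.1 1 - Finsupp.single e.1.2 1

lemma boundary_single (a : G.Edge) (r : ℝ) : G.boundary (Pi.single a r) =
    r • (Finsupp.single a.1.1 1 - Finsupp.single a.1.2 1) := by
  rw [boundary, Fintype.linearCombination_apply_single]

lemma boundary_apply (θ : G.Edge → ℝ) (x : V) : G.boundary θ x = G.div θ x := by
  classical
  simp only [boundary, Fintype.linearCombination_apply, Finsupp.finsetSum_apply,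
    Finsupp.smul_apply, Finsupp.sub_apply, Finsupp.single_apply, smul_eq_mul, mul_sub, mul_ite,
    mul_one, mul_zero, Finset.sum_sub_distrib, div, Finset.sum_filter]

lemma linearCombination_boundary (φ : V → ℝ) (θ : G.Edge → ℝ) :
    Finsupp.linearCombination ℝ φ (G.boundary θ) = ∑ e, θ e * (φ e.1.1 - φ e.1.2) := by
  simp [boundary, Fintype.linearCombination_apply]

lemma mem_affineSpace_iff {z : G.Edge → ℝ} : z ∈ G.affineSpace ↔
    G.boundary z = Finsupp.single G.x₀ 1 - Finsupp.single G.δ 1 := by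
  classical
  refine ⟨fun hz => ?_, fun hz x hx => ?_⟩
  · set d := G.boundary z - (Finsupp.single G.x₀ 1 - Finsupp.single G.δ 1) with hd
    have d_eq_single : d = Finsupp.single G.δ (d G.δ) := by
      ext x
      by_cases hx : x = G.δ
      · rw [hx, Finsupp.single_eq_same]
      · have := hz x hx
        simp only [hd, Finsupp.sub_apply, boundary_apply, this, Finsupp.single_apply, Ne.symm hx,
          eq_comm (a := G.x₀), if_false]
        simp
    have sum_d : Finsupp.linearCombination ℝ (fun _ : V => (1 : ℝ)) d = 0 := by
      simp [hd, linearCombination_boundary]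
    rw [d_eq_single, Finsupp.linearCombination_single, smul_eq_mul, mul_one] at sum_d
    rw [← sub_eq_zero, ← hd, d_eq_single, sum_d, Finsupp.single_zero]
  · rw [← boundary_apply, hz]
    simp [Finsupp.single_apply, Ne.symm hx, eq_comm]

/-- The pairing with the indicator function of the component of one end of `e` sees only `e`. -/
lemma eq_zero_of_not_reachable {θ : G.Edge → ℝ} (hθ : G.boundary θ = 0) {S : Finset G.Edge}
    {e : G.Edge} (hθS : ∀ a, a ≠ e → a ∉ S → θ a = 0)
    (he : ¬ (undirected S).Reachable e.1.1 e.1.2) : θ e = 0 := by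
  classical
  have pairing := linearCombination_boundary
    (fun x => if (undirected S).Reachable e.1.1 x then 1 else 0) θ
  rw [hθ, map_zero, Finset.sum_eq_single e] at pairing
  · simpa [he] using pairing.symm
  · intro a _ ha
    by_cases haS : a ∈ S
    · have reachable_iff : (undirected S).Reachable e.1.1 a.1.1 ↔
          (undirected S).Reachable e.1.1 a.1.2 :=
        ⟨fun h => h.trans (undirected_adj haS).reachable,
          fun h => h.trans (undirected_adj haS).symm.reachable⟩
      simp [reachable_iff]
    · rw [hθS a ha haS, zero_mul]
  · simp

lemma IsSpanningTree.eq_of_boundary_eq {T : Finset G.Edge} (hT : G.IsSpanningTree T)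
    {θ η : G.Edge → ℝ} (h : G.boundary θ = G.boundary η) (hS : ∀ a, a ∉ T → θ a = η a) :
    θ = η := by
  have boundary_sub : G.boundary (θ - η) = 0 := by rw [map_sub, h, sub_self]
  have sub_eq_zero_off : ∀ a, a ∉ T → (θ - η) a = 0 := fun a ha => by
    rw [Pi.sub_apply, hS a ha, sub_self]
  ext e
  by_cases he : e ∈ T
  · refine sub_eq_zero.1 (eq_zero_of_not_reachable boundary_sub (fun a hae ha => ?_)
      (hT.not_reachable_erase he))
    exact sub_eq_zero_off a fun haT => ha (Finset.mem_erase.2 ⟨hae, haT⟩)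
  · exact hS e he

open scoped Classical in
/-- The sign with which the edge `a` is used to go from `x` to `y`. -/
noncomputable def stepSign (a : G.Edge) (x y : V) : ℤ := if a.1 = (x, y) then 1 else -1

lemma boundary_single_stepSign {a : G.Edge} {x y : V} (h : G.Joins a x y) :
    G.boundary (Pi.single a (stepSign a x y : ℝ)) = Finsupp.single x 1 - Finsupp.single y 1 := by
  rw [boundary_single]
  have hne := ends_ne a
  rcases h with h | h <;> rw [h] at hne
  · simp [stepSign, h]
  · simp [stepSign, h, hne.symm]

lemma exists_boundary_eq_of_reachable {S : Finset G.Edge} {x y : V}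
    (h : (undirected S).Reachable x y) :
    ∃ θ, G.boundary θ = Finsupp.single x 1 - Finsupp.single y 1 ∧ ∀ a, a ∉ S → θ a = 0 := by
  obtain ⟨p⟩ := h
  induction p with
  | nil => exact ⟨0, by simp, by simp⟩
  | @cons x z _ hadj _ ih =>
    obtain ⟨a, ha, hj⟩ := hadj
    obtain ⟨θ, hθ, hθS⟩ := ih
    refine ⟨Pi.single a (stepSign a x z : ℝ) + θ, ?_, fun b hb => ?_⟩
    · rw [map_add, boundary_single_stepSign hj, hθ, sub_add_sub_cancel]
    · rw [Pi.add_apply, hθS b hb, Pi.single_eq_of_ne (fun h => hb (by rwa [h])), add_zero]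

lemma IsSpanningTree.exists_boundary_eq {T : Finset G.Edge} (hT : G.IsSpanningTree T)
    (η : G.Edge → ℝ) : ∃ θ, G.boundary θ = G.boundary η ∧ ∀ a, a ∉ T → θ a = 0 := by
  choose τ hτ hτT using fun e : G.Edge =>
    exists_boundary_eq_of_reachable ((isSpanningTree_iff.1 hT).2 e.1.1 e.1.2)
  refine ⟨∑ e, η e • τ e, ?_, fun a ha => ?_⟩
  · simp only [map_sum, map_smul, hτ]
    rw [boundary, Fintype.linearCombination_apply]
  · simp [hτT _ a ha]

/-! ### Chains of paths and cycles -/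

/-- The 1-chain `∑_{a ∈ S} ε(a) a` of a set `S` of edges with signs `ε`. -/
noncomputable def chain (S : Finset G.Edge) (ε : G.Edge → ℤ) : G.Edge → ℝ :=
  ∑ a ∈ S, Pi.single a (ε a : ℝ)

lemma chain_apply (S : Finset G.Edge) (ε : G.Edge → ℤ) (a : G.Edge) :
    chain S ε a = if a ∈ S then (ε a : ℝ) else 0 := by
  rw [chain, Finset.sum_apply, Finset.sum_pi_single]

lemma chain_apply_of_mem {S : Finset G.Edge} {a : G.Edge} (ha : a ∈ S) (ε : G.Edge → ℤ) :
    chain S ε a = ε a := by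
  rw [chain_apply, if_pos ha]

lemma chain_apply_of_notMem {S : Finset G.Edge} {a : G.Edge} (ha : a ∉ S) (ε : G.Edge → ℤ) :
    chain S ε a = 0 := by
  rw [chain_apply, if_neg ha]

lemma sum_mul_chain (S : Finset G.Edge) (ε : G.Edge → ℤ) (v : G.Edge → ℂ) :
    ∑ a, v a * (chain S ε a : ℂ) = G.linForm S ε v := by
  simp only [chain_apply, linForm, apply_ite Complex.ofReal, Complex.ofReal_intCast,
    Complex.ofReal_zero, ite_mul, zero_mul, Finset.sum_ite_mem, Finset.univ_inter,
    LinearMap.coe_sum, Finset.sum_apply, LinearMap.smul_apply, LinearMap.proj_apply, smul_eq_mul,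
    mul_comm (v _)]

lemma IsPathList.boundary_chain {x y : V} {σ : Finset G.Edge} {k : ℕ} {v : Fin (k + 1) → V}
    {e : Fin k → G.Edge} (h : G.IsPathList x y σ v e) {ε : G.Edge → ℤ}
    (hε : ∀ j, ε (e j) = stepSign (e j) (v j.castSucc) (v j.succ)) :
    G.boundary (chain σ ε) = Finsupp.single x 1 - Finsupp.single y 1 := by
  rw [chain, h.image_eq, Finset.sum_image h.injective_edges.injOn, map_sum]
  simp only [hε, boundary_single_stepSign (h.joins _)]
  have sum_succ := Fin.sum_univ_succ fun j => Finsupp.single (v j) (1 : ℝ)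
  rw [Fin.sum_univ_castSucc, h.start, h.finish] at sum_succ
  rw [Finset.sum_sub_distrib, sub_eq_sub_iff_add_eq_add, sum_succ]

lemma IsCycleOrientation.boundary_chain {C : Finset G.Edge} {ε : G.Edge → ℤ}
    (h : G.IsCycleOrientation C ε) : G.boundary (chain C ε) = 0 := by
  obtain ⟨k, v, e, h, hε⟩ := h
  rw [chain, h.image_eq, Finset.sum_image h.inj_edges.injOn, map_sum]
  have boundary_step (j) : G.boundary (Pi.single (e j) (ε (e j) : ℝ)) =
      Finsupp.single (v j) 1 - Finsupp.single (v (j + 1)) 1 := by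
    have sign_eq : ε (e j) = stepSign (e j) (v j) (v (j + 1)) := hε j
    rw [sign_eq, boundary_single_stepSign (h.joins j)]
  simp only [boundary_step, Finset.sum_sub_distrib, sub_eq_zero]
  exact (Equiv.sum_comp (Equiv.addRight 1) fun j => Finsupp.single (v j) (1 : ℝ)).symm

lemma IsCycleOrientation.eq_or {C : Finset G.Edge} {ε : G.Edge → ℤ}
    (h : G.IsCycleOrientation C ε) {a : G.Edge} (ha : a ∈ C) : ε a = 1 ∨ ε a = -1 := by
  obtain ⟨k, v, e, h, hε⟩ := h
  rw [h.image_eq] at ha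
  obtain ⟨j, -, rfl⟩ := Finset.mem_image.1 ha
  rw [hε]
  split_ifs <;> simp

lemma IsCycle.exists_isCycleOrientation {C : Finset G.Edge} (h : G.IsCycle C) :
    ∃ ε, G.IsCycleOrientation C ε := by
  obtain ⟨k, v, e, h⟩ := h
  exact ⟨Function.extend e (fun j => stepSign (e j) (v j) (v (j + 1))) 0, k, v, e, h,
    h.inj_edges.extend_apply _ _⟩

/-- The direction of an edge does not depend on the list exhibiting the path, because the chains
of two lists have the same boundary and lie in the same tree. -/
lemma IsSpanningTree.pathSign_eq_stepSign {T : Finset G.Edge} (hT : G.IsSpanningTree T) {x y : V}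
    {σ : Finset G.Edge} (hσT : σ ⊆ T) {k : ℕ} {v : Fin (k + 1) → V} {e : Fin k → G.Edge}
    (h : G.IsPathList x y σ v e) (j : Fin k) :
    G.pathSign x y σ (e j) = stepSign (e j) (v j.castSucc) (v j.succ) := by
  by_cases hj : (e j).1 = (v j.castSucc, v j.succ)
  · rw [stepSign, if_pos hj, pathSign, if_pos ⟨k, v, e, h, j, rfl, hj⟩]
  rw [stepSign, if_neg hj, pathSign, if_neg]
  rintro ⟨k', v', e', h', i, hi, hi'⟩
  have extend_eq := h.injective_edges.extend_apply
    (fun j => stepSign (e j) (v j.castSucc) (v j.succ)) 0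
  have extend_eq' := h'.injective_edges.extend_apply
    (fun j => stepSign (e' j) (v' j.castSucc) (v' j.succ)) 0
  have chain_eq := hT.eq_of_boundary_eq
    ((h.boundary_chain extend_eq).trans (h'.boundary_chain extend_eq').symm) fun a ha => by
      rw [chain_apply_of_notMem (fun h => ha (hσT h)), chain_apply_of_notMem fun h => ha (hσT h)]
  have sign_eq := congrFun chain_eq (e j)
  rw [chain_apply_of_mem (h.mem j), chain_apply_of_mem (h.mem j), extend_eq, ← hi, extend_eq', hi,
    stepSign, stepSign, if_neg hj, if_pos hi'] at sign_eq
  norm_num at sign_eq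

lemma IsSpanningTree.boundary_chain_pathSign {T : Finset G.Edge} (hT : G.IsSpanningTree T)
    {x y : V} {σ : Finset G.Edge} (hσ : G.IsSimplePath x y σ) (hσT : σ ⊆ T) :
    G.boundary (chain σ (G.pathSign x y σ)) = Finsupp.single x 1 - Finsupp.single y 1 := by
  obtain ⟨k, v, e, h⟩ := hσ
  exact h.boundary_chain (hT.pathSign_eq_stepSign hσT h)

lemma mem_iff_chain_ne_zero {S : Finset G.Edge} {ε : G.Edge → ℤ}
    (hε : ∀ a ∈ S, ε a = 1 ∨ ε a = -1) (a : G.Edge) : a ∈ S ↔ chain S ε a ≠ 0 := by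
  rw [chain_apply]
  split_ifs with ha
  · rcases hε a ha with h | h <;> simp [h, ha]
  · simp [ha]

lemma pathSign_eq_or (x y : V) (σ : Finset G.Edge) (a : G.Edge) :
    G.pathSign x y σ a = 1 ∨ G.pathSign x y σ a = -1 := by
  unfold pathSign
  split_ifs <;> simp

lemma IsSpanningTree.eq_of_isSimplePath {T : Finset G.Edge} (hT : G.IsSpanningTree T)
    {x y : V} {σ τ : Finset G.Edge} (hσ : G.IsSimplePath x y σ) (hσT : σ ⊆ T)
    (hτ : G.IsSimplePath x y τ) (hτT : τ ⊆ T) : σ = τ := by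
  have chain_eq := hT.eq_of_boundary_eq ((hT.boundary_chain_pathSign hσ hσT).trans
    (hT.boundary_chain_pathSign hτ hτT).symm) fun a ha => by
      rw [chain_apply_of_notMem (fun h => ha (hσT h)), chain_apply_of_notMem fun h => ha (hτT h)]
  ext a
  rw [mem_iff_chain_ne_zero (fun a _ => pathSign_eq_or x y σ a), chain_eq,
    ← mem_iff_chain_ne_zero fun a _ => pathSign_eq_or x y τ a]

/-! ### Fundamental cycles -/

/-- The edges outside `T`; for a spanning tree `T` they index the fundamental cycles. -/
abbrev Chord (T : Finset G.Edge) : Type _ := {e : G.Edge // e ∉ T}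

variable (G) in
/-- The space of real 1-cycles of the graph. -/
noncomputable abbrev circulations : Submodule ℝ (G.Edge → ℝ) := LinearMap.ker G.boundary

variable (G) in
/-- The restriction of circulations to the edges outside `T`. -/
noncomputable def restrictToChords (T : Finset G.Edge) :
    G.circulations →ₗ[ℝ] (Chord T → ℝ) :=
  LinearMap.funLeft ℝ ℝ Subtype.val ∘ₗ G.circulations.subtype

namespace IsSpanningTree

variable {T : Finset G.Edge} (hT : G.IsSpanningTree T)

include hT in
lemma bijective_restrictToChords : Function.Bijective (G.restrictToChords T) := by
  constructor
  · intro c d hcd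
    refine Subtype.ext (hT.eq_of_boundary_eq (c.2.trans d.2.symm) fun a ha => ?_)
    exact congrFun hcd ⟨a, ha⟩
  · intro y
    let η : G.Edge → ℝ := Function.extend Subtype.val y 0
    obtain ⟨θ, hθ, hθT⟩ := hT.exists_boundary_eq η
    refine ⟨⟨η - θ, by simp [hθ]⟩, ?_⟩
    ext i
    change η i - θ i = y i
    rw [hθT i i.2, sub_zero]
    exact Subtype.val_injective.extend_apply y 0 i

/-- A circulation is determined by its values outside a spanning tree, which are arbitrary. -/
noncomputable def circulationEquiv : G.circulations ≃ₗ[ℝ] (Chord T → ℝ) :=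
  LinearEquiv.ofBijective (G.restrictToChords T) hT.bijective_restrictToChords

/-- The circulation along the fundamental cycle of the chord `i`, oriented along `i`. -/
noncomputable def fundamentalFlow (i : Chord T) : G.Edge → ℝ :=
  hT.circulationEquiv.symm (Pi.single i 1)

lemma circulationEquiv_symm_apply_chord (y : Chord T → ℝ) (i : Chord T) :
    (hT.circulationEquiv.symm y : G.Edge → ℝ) i = y i :=
  congrFun (hT.circulationEquiv.apply_symm_apply y) i

lemma circulationEquiv_symm_eq_sum (y : Chord T → ℝ) :
    (hT.circulationEquiv.symm y : G.Edge → ℝ) = ∑ i, y i • hT.fundamentalFlow i := by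
  conv_lhs => rw [pi_eq_sum_univ' y]
  simp [fundamentalFlow]

lemma boundary_fundamentalFlow (i : Chord T) : G.boundary (hT.fundamentalFlow i) = 0 :=
  (hT.circulationEquiv.symm (Pi.single i 1)).2

/-- The support of the fundamental flow of `i`, which is the only cycle contained in
`T ∪ {i}`. -/
noncomputable def fundamentalCycle (i : Chord T) : Finset G.Edge :=
  {a | hT.fundamentalFlow i a ≠ 0}

include hT in
lemma mem_of_isCycle_of_subset_insert {C : Finset G.Edge} {e₀ : G.Edge} (hC : G.IsCycle C)
    (hCT : C ⊆ insert e₀ T) : e₀ ∈ C := by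
  by_contra h
  exact hT.1 C hC ((Finset.subset_insert_iff_of_notMem h).1 hCT)

lemma fundamentalFlow_eq_smul_chain {C : Finset G.Edge} {ε : G.Edge → ℤ} {i : Chord T}
    (hC : G.IsCycle C) (hCT : C ⊆ insert i.1 T) (hε : G.IsCycleOrientation C ε) :
    hT.fundamentalFlow i = (ε i : ℝ) • chain C ε := by
  have hi := hT.mem_of_isCycle_of_subset_insert hC hCT
  refine hT.eq_of_boundary_eq ?_ fun a ha => ?_
  · rw [hT.boundary_fundamentalFlow, map_smul, hε.boundary_chain, smul_zero]
  · rw [fundamentalFlow, hT.circulationEquiv_symm_apply_chord _ ⟨a, ha⟩, Pi.smul_apply]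
    by_cases hai : a = i
    · subst hai
      rw [Pi.single_eq_same, chain_apply_of_mem hi, smul_eq_mul]
      rcases hε.eq_or hi with h | h <;> simp [h]
    · have haC : a ∉ C := fun h => (Finset.mem_insert.1 (hCT h)).elim hai ha
      rw [chain_apply_of_notMem haC, smul_zero,
        Pi.single_eq_of_ne fun h => hai (congrArg Subtype.val h)]

lemma eq_fundamentalCycle {C : Finset G.Edge} {i : Chord T} (hC : G.IsCycle C)
    (hCT : C ⊆ insert i.1 T) : C = hT.fundamentalCycle i := by
  obtain ⟨ε, hε⟩ := hC.exists_isCycleOrientation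
  have ε_ne_zero : (ε i : ℝ) ≠ 0 := by
    rcases hε.eq_or (hT.mem_of_isCycle_of_subset_insert hC hCT) with h | h <;> simp [h]
  ext a
  rw [fundamentalCycle, Finset.mem_filter_univ, hT.fundamentalFlow_eq_smul_chain hC hCT hε,
    Pi.smul_apply, smul_ne_zero_iff_right ε_ne_zero,
    mem_iff_chain_ne_zero (fun a ha => hε.eq_or ha)]

lemma isCycle_fundamentalCycle_and_subset (i : Chord T) :
    G.IsCycle (hT.fundamentalCycle i) ∧ hT.fundamentalCycle i ⊆ insert i.1 T := by
  obtain ⟨σ, hσ, hσT⟩ := hT.2 i.1.1.2 i.1.1.1 (ends_ne i.1).symm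
  have hC := hσ.isCycle_insert fun h => i.2 (hσT h)
  have hCT := Finset.insert_subset_insert i.1 hσT
  exact hT.eq_fundamentalCycle hC hCT ▸ ⟨hC, hCT⟩

lemma isCycle_fundamentalCycle (i : Chord T) : G.IsCycle (hT.fundamentalCycle i) :=
  (hT.isCycle_fundamentalCycle_and_subset i).1

lemma fundamentalCycle_subset (i : Chord T) : hT.fundamentalCycle i ⊆ insert i.1 T :=
  (hT.isCycle_fundamentalCycle_and_subset i).2

lemma mem_fundamentalCycle (i : Chord T) : i.1 ∈ hT.fundamentalCycle i :=
  hT.mem_of_isCycle_of_subset_insert (hT.isCycle_fundamentalCycle i) (hT.fundamentalCycle_subset i)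

lemma fundamentalFlow_eq {i : Chord T} {ε : G.Edge → ℤ}
    (hε : G.IsCycleOrientation (hT.fundamentalCycle i) ε) :
    hT.fundamentalFlow i = (ε i : ℝ) • chain (hT.fundamentalCycle i) ε :=
  hT.fundamentalFlow_eq_smul_chain (hT.isCycle_fundamentalCycle i) (hT.fundamentalCycle_subset i) hε

lemma fundamentalFlow_apply {i : Chord T} {ε : G.Edge → ℤ}
    (hε : G.IsCycleOrientation (hT.fundamentalCycle i) ε) {a : G.Edge}
    (ha : a ∈ hT.fundamentalCycle i) : hT.fundamentalFlow i a = ε i * ε a := by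
  rw [hT.fundamentalFlow_eq hε, Pi.smul_apply, chain_apply_of_mem ha, smul_eq_mul]

lemma abs_fundamentalFlow {i : Chord T} {a : G.Edge} (ha : a ∈ hT.fundamentalCycle i) :
    |hT.fundamentalFlow i a| = 1 := by
  obtain ⟨ε, hε⟩ := (hT.isCycle_fundamentalCycle i).exists_isCycleOrientation
  rw [hT.fundamentalFlow_apply hε ha]
  rcases hε.eq_or (hT.mem_fundamentalCycle i) with h | h <;>
    rcases hε.eq_or ha with h' | h' <;> simp [h, h']

lemma fundamentalFlow_of_notMem {i : Chord T} {a : G.Edge} (ha : a ∉ hT.fundamentalCycle i) :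
    hT.fundamentalFlow i a = 0 := by
  simpa [fundamentalCycle] using ha

lemma exchange {i : Chord T} {e : G.Edge} (he : e ∈ hT.fundamentalCycle i) :
    G.IsSpanningTree ((insert i.1 T).erase e) := by
  rw [isSpanningTree_iff]
  constructor
  · intro D hD hDT
    rw [hT.eq_fundamentalCycle hD (hDT.trans (Finset.erase_subset _ _))] at hDT
    exact Finset.notMem_erase e _ (hDT he)
  have ends_reachable : (undirected ((insert i.1 T).erase e)).Reachable e.1.1 e.1.2 := by
    by_contra hcon
    have flow_eq_zero := eq_zero_of_not_reachable (hT.boundary_fundamentalFlow i)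
      (fun a hae ha => hT.fundamentalFlow_of_notMem fun haC =>
        ha (Finset.mem_erase.2 ⟨hae, hT.fundamentalCycle_subset i haC⟩)) hcon
    simpa [flow_eq_zero] using hT.abs_fundamentalFlow he
  have reachable_of_adj : ∀ x y, (undirected T).Adj x y →
      (undirected ((insert i.1 T).erase e)).Reachable x y := by
    rintro x y ⟨a, ha, hj⟩
    by_cases hae : a = e
    · subst hae
      rcases hj with hj | hj <;> rw [hj] at ends_reachable
      exacts [ends_reachable, ends_reachable.symm]
    · exact SimpleGraph.Adj.reachable
        ⟨a, Finset.mem_erase.2 ⟨hae, Finset.mem_insert_of_mem ha⟩, hj⟩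
  intro x y
  obtain ⟨p⟩ := (isSpanningTree_iff.1 hT).2 x y
  induction p with
  | nil => rfl
  | cons h _ ih => exact (reachable_of_adj _ _ h).trans ih

/-! ### Coordinates on the affine space -/

/-- The simple path from `x₀` to `δ` in a spanning tree. -/
noncomputable def rootPath : Finset G.Edge := (hT.2 _ _ G.x₀_ne_δ).choose

lemma isSimplePath_rootPath : G.IsSimplePath G.x₀ G.δ hT.rootPath :=
  (hT.2 _ _ G.x₀_ne_δ).choose_spec.1

lemma rootPath_subset : hT.rootPath ⊆ T := (hT.2 _ _ G.x₀_ne_δ).choose_spec.2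

lemma subset_iff_eq_rootPath {σ : Finset G.Edge} (hσ : G.IsSimplePath G.x₀ G.δ σ) :
    σ ⊆ T ↔ σ = hT.rootPath :=
  ⟨fun h => hT.eq_of_isSimplePath hσ h hT.isSimplePath_rootPath hT.rootPath_subset,
    fun h => h ▸ hT.rootPath_subset⟩

/-- The unit flow from `x₀` to `δ` carried by a spanning tree. -/
noncomputable def rootFlow : G.Edge → ℝ := chain hT.rootPath (G.pathSign G.x₀ G.δ hT.rootPath)

lemma boundary_rootFlow :
    G.boundary hT.rootFlow = Finsupp.single G.x₀ 1 - Finsupp.single G.δ 1 :=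
  hT.boundary_chain_pathSign hT.isSimplePath_rootPath hT.rootPath_subset

lemma rootFlow_of_notMem {a : G.Edge} (ha : a ∉ T) : hT.rootFlow a = 0 :=
  chain_apply_of_notMem (fun h => ha (hT.rootPath_subset h)) _

/-- The parametrization of the affine space by the coordinates outside a spanning tree. -/
noncomputable def param : (Chord T → ℝ) →ᵃ[ℝ] (G.Edge → ℝ) :=
  (G.circulations.subtype ∘ₗ hT.circulationEquiv.symm.toLinearMap).toAffineMap +
    AffineMap.const ℝ _ hT.rootFlow

lemma param_apply (y : Chord T → ℝ) :
    hT.param y = hT.circulationEquiv.symm y + hT.rootFlow := rfl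

lemma param_linear_single (i : Chord T) :
    hT.param.linear (Pi.single i 1) = hT.fundamentalFlow i := by
  simp [param, fundamentalFlow]

lemma param_apply_chord (y : Chord T → ℝ) (i : Chord T) : hT.param y i = y i := by
  rw [param_apply, Pi.add_apply, hT.circulationEquiv_symm_apply_chord, hT.rootFlow_of_notMem i.2,
    add_zero]

lemma param_mem_affineSpace (y : Chord T → ℝ) : hT.param y ∈ G.affineSpace := by
  have boundary_eq_zero : G.boundary (hT.circulationEquiv.symm y : G.Edge → ℝ) = 0 :=
    (hT.circulationEquiv.symm y).2
  rw [mem_affineSpace_iff, param_apply, map_add, boundary_eq_zero, zero_add, boundary_rootFlow]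

lemma param_chords {z : G.Edge → ℝ} (hz : z ∈ G.affineSpace) :
    hT.param (fun i => z i) = z :=
  hT.eq_of_boundary_eq ((mem_affineSpace_iff.1 (hT.param_mem_affineSpace _)).trans
    (mem_affineSpace_iff.1 hz).symm) fun a ha => hT.param_apply_chord _ ⟨a, ha⟩

lemma eq_rootFlow_add_sum {z : G.Edge → ℝ} (hz : z ∈ G.affineSpace) :
    z = hT.rootFlow + ∑ i : Chord T, z i • hT.fundamentalFlow i := by
  conv_lhs => rw [← hT.param_chords hz, param_apply, circulationEquiv_symm_eq_sum, add_comm]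

/-- The affine space in the coordinates `(z_e)_{e ∉ T}`. -/
noncomputable def coordEquiv : G.affineSpace ≃ᵐ (Chord T → ℝ) where
  toFun z i := z.1 i
  invFun y := ⟨hT.param y, hT.param_mem_affineSpace y⟩
  left_inv z := Subtype.ext (hT.param_chords z.2)
  right_inv y := funext (hT.param_apply_chord y)
  measurable_toFun := measurable_pi_lambda _ fun i =>
    (measurable_pi_apply i.1).comp measurable_subtype_coe
  measurable_invFun := hT.param.continuous_of_finiteDimensional.measurable.subtype_mk

lemma coordEquiv_apply (z : G.affineSpace) (i : Chord T) : hT.coordEquiv z i = z.1 i := rfl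

lemma coe_coordEquiv_symm (y : Chord T → ℝ) : (hT.coordEquiv.symm y : G.Edge → ℝ) = hT.param y :=
  rfl

lemma measurePreserving_coordEquiv_symm :
    MeasurePreserving hT.coordEquiv.symm volume (G.coordVolume T) :=
  ⟨hT.coordEquiv.symm.measurable, hT.coordEquiv.map_symm⟩

/-- The bijection of the chords of `T` with those of `T ∪ {i} \ {e}` which replaces `i` by `e`. -/
noncomputable def exchangeEquiv {i : Chord T} {e : G.Edge} (he : e ∈ insert i.1 T) :
    Chord T ≃ Chord ((insert i.1 T).erase e) :=
  Equiv.ofBijective (fun j => ⟨if j = i then e else j, by grind⟩) <| by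
    constructor
    · intro j k hjk
      have := j.2
      have := k.2
      grind
    · rintro ⟨a, ha⟩
      by_cases hae : a = e
      · exact ⟨i, by simp [hae]⟩
      · exact ⟨⟨a, by grind⟩, by grind⟩

lemma coe_exchangeEquiv {i : Chord T} {e : G.Edge} (he : e ∈ insert i.1 T) (j : Chord T) :
    (exchangeEquiv he j : G.Edge) = if j = i then e else j := rfl

/-- Exchanging the chord `i` for the edge `e` of its fundamental cycle replaces the coordinate `z_i`
by `z_e`, which is an affine function of the old coordinates with coefficient `±1` at `z_i`. -/
lemma coordVolume_exchange {i : Chord T} {e : G.Edge} (he : e ∈ hT.fundamentalCycle i) :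
    G.coordVolume ((insert i.1 T).erase e) = G.coordVolume T := by
  have hT' := hT.exchange he
  let κ := exchangeEquiv (hT.fundamentalCycle_subset i he)
  let L : (Chord T → ℝ) →ᵃ[ℝ] ℝ := (LinearMap.proj e).toAffineMap.comp hT.param
  have preserves_update : MeasurePreserving fun y => Function.update y i (L y) := by
    refine measurePreserving_update_affineMap L ?_
    have linear_single : L.linear (Pi.single i 1) = hT.fundamentalFlow i e :=
      congrFun (hT.param_linear_single i) e
    rw [linear_single, hT.abs_fundamentalFlow he]
  have preserves_reindex := volume_measurePreserving_piCongrLeft (fun _ => ℝ) κ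
  have preserves := hT'.measurePreserving_coordEquiv_symm.comp
    (preserves_reindex.comp preserves_update)
  have symm_eq : hT'.coordEquiv.symm ∘ MeasurableEquiv.piCongrLeft (fun _ => ℝ) κ ∘
      (fun y => Function.update y i (L y)) = hT.coordEquiv.symm := by
    ext1 y
    refine hT'.coordEquiv.symm_apply_eq.2 (funext fun j => ?_)
    obtain ⟨k, rfl⟩ := κ.surjective j
    rw [MeasurableEquiv.coe_piCongrLeft, Function.comp_apply, Equiv.piCongrLeft_apply_apply,
      coordEquiv_apply, coe_coordEquiv_symm, coe_exchangeEquiv]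
    by_cases hk : k = i
    · rw [hk, if_pos rfl, Function.update_self]
      rfl
    · rw [if_neg hk, Function.update_of_ne hk, hT.param_apply_chord]
  rw [← preserves.map_eq, symm_eq, hT.measurePreserving_coordEquiv_symm.map_eq]

end IsSpanningTree

/-! ### The integrand -/

lemma measurable_coord (e : G.Edge) : Measurable fun z : G.affineSpace => z.1 e :=
  (measurable_pi_apply e).comp measurable_subtype_coe

lemma measurable_integrand (α : G.Edge → ℝ) (S : Finset G.Edge) (l : G.Edge → ℂ) :
    Measurable (G.integrand α S l) := by
  have measurable_exponent : Measurable fun z : G.affineSpace => ∑ e, l e * (z.1 e : ℂ) :=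
    Finset.measurable_sum _ fun e _ => (measurable_coord e).complex_ofReal.const_mul _
  have measurable_prod_rpow : Measurable fun z : G.affineSpace => ∏ e, z.1 e ^ α e :=
    Finset.measurable_prod _ fun e _ => (measurable_coord e).pow_const _
  have measurable_prod_inv : Measurable fun z : G.affineSpace => ∏ e ∈ Sᶜ, (z.1 e)⁻¹ :=
    Finset.measurable_prod _ fun e _ => (measurable_coord e).inv
  exact measurable_exponent.neg.cexp.mul
    (measurable_prod_rpow.mul measurable_prod_inv).complex_ofReal

lemma measurableSet_chamber : MeasurableSet G.chamber := by
  simp only [chamber, Set.ofPred_forall]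
  exact MeasurableSet.iInter fun e => measurableSet_lt measurable_const (measurable_coord e)

lemma integrand_erase (α : G.Edge → ℝ) {S : Finset G.Edge} {e : G.Edge} (he : e ∈ S)
    (l : G.Edge → ℂ) (z : G.affineSpace) :
    G.integrand α (S.erase e) l z = (z.1 e)⁻¹ • G.integrand α S l z := by
  unfold integrand
  rw [Finset.compl_erase, Finset.prod_insert (by simpa using he), Complex.real_smul]
  push_cast
  ring

lemma integrand_insert (α : G.Edge → ℝ) {S : Finset G.Edge} {e : G.Edge} (he : e ∉ S)
    (l : G.Edge → ℂ) {z : G.affineSpace} (hz : z ∈ G.chamber) :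
    G.integrand α (insert e S) l z = z.1 e • G.integrand α S l z := by
  have erase_eq := integrand_erase α (Finset.mem_insert_self e S) l z
  rw [Finset.erase_insert he] at erase_eq
  rw [erase_eq, smul_inv_smul₀ (hz e).ne']

lemma norm_integrand (α : G.Edge → ℝ) (S : Finset G.Edge) (l : G.Edge → ℂ) (z : G.affineSpace) :
    ‖G.integrand α S l z‖ = Real.exp (-∑ e, (l e).re * z.1 e) *
      |(∏ e, (z.1 e) ^ (α e)) * ∏ e ∈ Sᶜ, (z.1 e)⁻¹| := by
  rw [integrand, norm_mul, Complex.norm_real, Real.norm_eq_abs, Complex.norm_exp]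
  simp

lemma norm_smul_integrand_le (α : G.Edge → ℝ) (S : Finset G.Edge) {l : G.Edge → ℂ}
    {m : G.Edge → ℝ} (hm : ∀ e, 0 < m e) (hl : ∀ e, 2 * m e ≤ (l e).re) {z : G.affineSpace}
    (hz : z ∈ G.chamber) (a : G.Edge) : ‖z.1 a • G.integrand α S l z‖ ≤
      (m a)⁻¹ * ‖G.integrand α S (fun e => (m e : ℂ)) z‖ := by
  simp only [norm_smul, Real.norm_of_nonneg (hz a).le, norm_integrand, ← mul_assoc,
    Complex.ofReal_re]
  gcongr ?_ * _
  exact mul_exp_neg_sum_le hm hl (fun e => (hz e).le) a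

namespace IntegralsWellDefined

variable {α : G.Edge → ℝ} (hα : G.IntegralsWellDefined α)

include hα

lemma integrableOn_smul {T : Finset G.Edge} (hT : G.IsSpanningTree T) {l : G.Edge → ℂ}
    (hl : l ∈ G.rightDomain) (a : G.Edge) :
    IntegrableOn (fun z => z.1 a • G.integrand α T l z) G.chamber (G.coordVolume T) := by
  have half_pos (e) : 0 < (l e).re / 2 := half_pos (hl e)
  refine ((hα ⟨T, hT⟩ (fun e => ((l e).re / 2 : ℝ)) half_pos).norm.const_mul
    ((l a).re / 2)⁻¹).mono' ?_ ?_
  · exact ((measurable_coord a).smul (measurable_integrand α T l)).aestronglyMeasurable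
  · exact ae_restrict_of_forall_mem measurableSet_chamber fun z hz =>
      norm_smul_integrand_le α T half_pos (fun e => (mul_div_cancel₀ _ two_ne_zero).le) hz a

end IntegralsWellDefined

/-- The integral `I_{Δ,S}(l)`, for an arbitrary set `S` of edges. -/
noncomputable def treeIntegral (α : G.Edge → ℝ) (S : Finset G.Edge) (l : G.Edge → ℂ) : ℂ :=
  ∫ z in G.chamber, G.integrand α S l z ∂(G.coordVolume S)

/-- The moment `∫ z_a exp (-⟨l, z⟩) ∏_e z_e ^ α_e ω_T`, which is `-∂I_{Δ,T}/∂l_a`. -/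
noncomputable def moment (α : G.Edge → ℝ) (T : Finset G.Edge) (l : G.Edge → ℂ) (a : G.Edge) : ℂ :=
  ∫ z in G.chamber, z.1 a • G.integrand α T l z ∂(G.coordVolume T)

lemma moment_chord (α : G.Edge → ℝ) {T : Finset G.Edge} (i : Chord T) (l : G.Edge → ℂ) :
    moment α T l i = ∫ z in G.chamber, G.integrand α (insert i.1 T) l z ∂(G.coordVolume T) :=
  setIntegral_congr_fun measurableSet_chamber fun _ hz => (integrand_insert α i.2 l hz).symm

/-! ### Integration by parts along a fundamental cycle -/

/-- The function `exp (-⟨l, z⟩) ∏_e z_e ^ β_e` for positive `z`. -/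
noncomputable def expMonomial (l : G.Edge → ℂ) (β : G.Edge → ℝ) (z : G.Edge → ℝ) : ℂ :=
  Complex.exp (∑ e, ((β e * Real.log (z e) : ℝ) - l e * z e))

lemma integrand_eq_expMonomial (α : G.Edge → ℝ) (S : Finset G.Edge) (l : G.Edge → ℂ)
    {z : G.affineSpace} (hz : z ∈ G.chamber) : G.integrand α S l z =
      expMonomial l (fun e => α e - if e ∈ S then 0 else 1) z.1 := by
  have prod_compl : ∏ e ∈ Sᶜ, (z.1 e)⁻¹ = ∏ e, if e ∈ S then 1 else (z.1 e)⁻¹ := by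
    rw [Finset.prod_ite, Finset.prod_const_one, one_mul, Finset.filter_notMem_eq_sdiff,
      Finset.compl_eq_univ_sdiff]
  rw [integrand, expMonomial, Finset.sum_sub_distrib, sub_eq_neg_add, Complex.exp_add,
    prod_compl, ← Finset.prod_mul_distrib, ← Complex.ofReal_sum, ← Complex.ofReal_exp,
    Real.exp_sum]
  congr 2
  refine Finset.prod_congr rfl fun e _ => ?_
  rw [mul_comm _ (Real.log _), ← Real.rpow_def_of_pos (hz e)]
  split_ifs
  · rw [mul_one, sub_zero]
  · rw [Real.rpow_sub_one (hz e).ne', div_eq_mul_inv]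

lemma hasLineDerivAt_expMonomial (l : G.Edge → ℂ) (β : G.Edge → ℝ) {z : G.Edge → ℝ}
    (hz : ∀ e, 0 < z e) (c : G.Edge → ℝ) :
    HasLineDerivAt ℝ (expMonomial l β)
      (∑ e, ((β e * c e / z e : ℝ) - l e * c e) * expMonomial l β z) z c := by
  have hasDerivAt_coord (e) : HasDerivAt (fun t : ℝ => z e + t * c e) (c e) 0 := by
    simpa using ((hasDerivAt_id (0 : ℝ)).mul_const (c e)).const_add (z e)
  have hasDerivAt_term (e) : HasDerivAt (fun t : ℝ =>
      ((β e * Real.log (z e + t * c e) : ℝ) - l e * ((z e + t * c e : ℝ) : ℂ)))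
      ((β e * c e / z e : ℝ) - l e * c e) 0 := by
    have hasDerivAt_log := (hasDerivAt_coord e).log (by simpa using (hz e).ne')
    rw [zero_mul, add_zero] at hasDerivAt_log
    simpa only [mul_div_assoc] using (hasDerivAt_log.const_mul (β e)).ofReal_comp.fun_sub
      ((hasDerivAt_coord e).ofReal_comp.const_mul (l e))
  have hasDerivAt_exp := (HasDerivAt.fun_sum (u := Finset.univ) fun e _ => hasDerivAt_term e).cexp
  simpa only [HasLineDerivAt, expMonomial, Pi.add_apply, Pi.smul_apply, smul_eq_mul, zero_mul,
    add_zero, ← Finset.sum_mul, mul_comm (Complex.exp _)] using hasDerivAt_exp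

namespace IsSpanningTree

variable {T : Finset G.Edge} (hT : G.IsSpanningTree T)

include hT

theorem integral_chamber_lineDeriv_eq_zero {F : Type*} [NormedAddCommGroup F] [NormedSpace ℝ F]
    {i : Chord T} {f f' : (G.Edge → ℝ) → F}
    (hderiv : ∀ z, (∀ e, 0 < z e) → HasLineDerivAt ℝ f (f' z) z (hT.fundamentalFlow i))
    (hf : IntegrableOn (fun z : G.affineSpace => f z) G.chamber (G.coordVolume T))
    (hf' : IntegrableOn (fun z : G.affineSpace => f' z) G.chamber (G.coordVolume T))
    (hfC : ∀ e ∈ hT.fundamentalCycle i, IntegrableOn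
      (fun z : G.affineSpace => (z.1 e)⁻¹ • f z) G.chamber (G.coordVolume T)) :
    ∫ z in G.chamber, f' z ∂(G.coordVolume T) = 0 := by
  let L (e : G.Edge) : (Chord T → ℝ) →ᵃ[ℝ] ℝ := (LinearMap.proj e).toAffineMap.comp hT.param
  have preserves := hT.measurePreserving_coordEquiv_symm
  have embedding := hT.coordEquiv.symm.measurableEmbedding
  have integrableOn_comp {g : G.affineSpace → F} :=
    (preserves.integrableOn_comp_preimage embedding (f := g) (s := G.chamber)).2
  rw [← preserves.setIntegral_preimage_emb embedding]
  refine openPolyhedron.integral_lineDeriv_eq_zero (L := L) (f := f ∘ hT.param)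
    (v := Pi.single i 1) (fun y hy => hasLineDerivAt_comp_affineMap _ ?_)
    (integrableOn_comp hf) (integrableOn_comp hf') fun e he => ?_
  · rw [hT.param_linear_single]
    exact hderiv _ hy
  · refine integrableOn_comp (hfC e ?_)
    have linear_single : (L e).linear (Pi.single i 1) = hT.fundamentalFlow i e :=
      congrFun (hT.param_linear_single i) e
    simpa [linear_single, fundamentalCycle] using he

lemma treeIntegral_exchange (α : G.Edge → ℝ) {i : Chord T} {e : G.Edge}
    (he : e ∈ hT.fundamentalCycle i) (l : G.Edge → ℂ) :
    treeIntegral α ((insert i.1 T).erase e) l =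
      ∫ z in G.chamber, (z.1 e)⁻¹ • G.integrand α (insert i.1 T) l z ∂(G.coordVolume T) := by
  simp only [treeIntegral, hT.coordVolume_exchange he,
    integrand_erase α (hT.fundamentalCycle_subset i he)]

lemma lineDeriv_integrand_insert (α : G.Edge → ℝ) (i : Chord T) (l : G.Edge → ℂ)
    (z : G.affineSpace) :
    ∑ e, (((α e - if e ∈ insert i.1 T then 0 else 1) * hT.fundamentalFlow i e / z.1 e : ℝ) -
        l e * hT.fundamentalFlow i e) * G.integrand α (insert i.1 T) l z =
      ∑ e ∈ hT.fundamentalCycle i, (α e * hT.fundamentalFlow i e : ℂ) *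
          ((z.1 e)⁻¹ • G.integrand α (insert i.1 T) l z) -
        (∑ e, l e * hT.fundamentalFlow i e) * G.integrand α (insert i.1 T) l z := by
  have sum_exponents : ∑ e, ((α e - if e ∈ insert i.1 T then 0 else 1) *
      hT.fundamentalFlow i e / z.1 e : ℝ) =
        ∑ e ∈ hT.fundamentalCycle i, α e * hT.fundamentalFlow i e / z.1 e := by
    rw [← Finset.sum_subset (Finset.subset_univ (hT.fundamentalCycle i)) fun e _ he => by
      rw [hT.fundamentalFlow_of_notMem he, mul_zero, zero_div]]
    exact Finset.sum_congr rfl fun e he => by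
      rw [if_pos (hT.fundamentalCycle_subset i he), sub_zero]
  rw [← Finset.sum_mul, Finset.sum_sub_distrib, sub_mul, ← Complex.ofReal_sum, sum_exponents,
    Complex.ofReal_sum, Finset.sum_mul]
  congr 1
  refine Finset.sum_congr rfl fun e _ => ?_
  rw [Complex.real_smul]
  push_cast
  ring

end IsSpanningTree

lemma IntegralsWellDefined.integrableOn_exchange {α : G.Edge → ℝ}
    (hα : G.IntegralsWellDefined α) {T : Finset G.Edge} (hT : G.IsSpanningTree T) {l : G.Edge → ℂ}
    (hl : l ∈ G.rightDomain) {i : Chord T} {e : G.Edge} (he : e ∈ hT.fundamentalCycle i) :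
    IntegrableOn (fun z => (z.1 e)⁻¹ • G.integrand α (insert i.1 T) l z) G.chamber
      (G.coordVolume T) := by
  have integrableOn_integrand := hα ⟨_, hT.exchange he⟩ l hl
  rw [hT.coordVolume_exchange he] at integrableOn_integrand
  exact integrableOn_integrand.congr_fun
    (fun z _ => integrand_erase α (hT.fundamentalCycle_subset i he) l z) measurableSet_chamber

theorem IntegralsWellDefined.sum_mul_fundamentalFlow_mul_moment
    {α : G.Edge → ℝ} (hα : G.IntegralsWellDefined α)
    {T : Finset G.Edge} (hT : G.IsSpanningTree T) {l : G.Edge → ℂ}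
    (hl : l ∈ G.rightDomain) (i : Chord T) :
    (∑ e, l e * hT.fundamentalFlow i e) * moment α T l i =
      ∑ e ∈ hT.fundamentalCycle i, (α e * hT.fundamentalFlow i e : ℂ) *
        treeIntegral α ((insert i.1 T).erase e) l := by
  set f := G.integrand α (insert i.1 T) l
  have integrableOn_f : IntegrableOn f G.chamber (G.coordVolume T) :=
    (hα.integrableOn_smul hT hl i).congr_fun
      (fun z hz => (integrand_insert α i.2 l hz).symm) measurableSet_chamber
  have integrableOn_div {e} := hα.integrableOn_exchange hT hl (i := i) (e := e)
  have integrableOn_term (e) (he : e ∈ hT.fundamentalCycle i) : IntegrableOn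
      (fun z => (α e * hT.fundamentalFlow i e : ℂ) * ((z.1 e)⁻¹ • f z)) G.chamber
        (G.coordVolume T) :=
    (integrableOn_div he).const_mul _
  have integrableOn_sum : IntegrableOn (fun z => ∑ e ∈ hT.fundamentalCycle i,
      (α e * hT.fundamentalFlow i e : ℂ) * ((z.1 e)⁻¹ • f z)) G.chamber (G.coordVolume T) :=
    integrable_finsetSum _ integrableOn_term
  have integrableOn_mul := integrableOn_f.const_mul (∑ e, l e * hT.fundamentalFlow i e)
  have integral_eq_zero := hT.integral_chamber_lineDeriv_eq_zero
    (fun z hz => hasLineDerivAt_expMonomial l _ hz (hT.fundamentalFlow i))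
    (integrableOn_f.congr_fun (fun z hz => integrand_eq_expMonomial α _ l hz)
      measurableSet_chamber)
    (IntegrableOn.congr_fun (integrableOn_sum.sub integrableOn_mul) (fun z hz => by
      rw [← integrand_eq_expMonomial α _ l hz, hT.lineDeriv_integrand_insert α i l z]
      rfl) measurableSet_chamber)
    (fun e he => (integrableOn_div he).congr_fun (fun z hz => by
      rw [← integrand_eq_expMonomial α _ l hz]) measurableSet_chamber)
  rw [setIntegral_congr_fun measurableSet_chamber fun z hz => by
      rw [← integrand_eq_expMonomial α _ l hz, hT.lineDeriv_integrand_insert α i l z],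
    integral_sub integrableOn_sum integrableOn_mul, integral_const_mul,
    integral_finsetSum _ integrableOn_term, sub_eq_zero] at integral_eq_zero
  rw [moment_chord, ← integral_eq_zero]
  refine Finset.sum_congr rfl fun e he => ?_
  rw [integral_const_mul, hT.treeIntegral_exchange α he]

/-! ### Differentiation under the integral sign -/

lemma hasFDerivAt_integrand (α : G.Edge → ℝ) (S : Finset G.Edge) (l : G.Edge → ℂ)
    (z : G.affineSpace) : HasFDerivAt (fun l => G.integrand α S l z)
      (-∑ a, (z.1 a • G.integrand α S l z) •
        (ContinuousLinearMap.proj a : (G.Edge → ℂ) →L[ℂ] ℂ)) l := by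
  have hasFDerivAt_exponent : HasFDerivAt (fun l : G.Edge → ℂ => ∑ e, l e * (z.1 e : ℂ))
      (∑ a, (z.1 a : ℂ) • (ContinuousLinearMap.proj a : (G.Edge → ℂ) →L[ℂ] ℂ)) l :=
    HasFDerivAt.fun_sum fun a _ => (hasFDerivAt_apply a l).mul_const _
  refine (hasFDerivAt_exponent.neg.cexp.mul_const _).congr_fderiv ?_
  simp only [smul_neg, Finset.smul_sum, smul_smul, integrand, Complex.real_smul, Pi.neg_apply]
  congr! 3
  ring

lemma eventually_le_re {l : G.Edge → ℂ} {m : G.Edge → ℝ} (hm : ∀ e, m e < (l e).re) :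
    ∀ᶠ l' in 𝓝 l, ∀ e, m e ≤ (l' e).re :=
  eventually_all.2 fun e => by
    have continuous_re : Continuous fun l' : G.Edge → ℂ => (l' e).re :=
      Complex.continuous_re.comp (continuous_apply e)
    exact (continuous_re.continuousAt.eventually_const_lt (hm e)).mono fun _ => le_of_lt

lemma norm_fderiv_integrand_le (α : G.Edge → ℝ) (S : Finset G.Edge) {l : G.Edge → ℂ}
    {m : G.Edge → ℝ} (hm : ∀ e, 0 < m e) (hl : ∀ e, 2 * m e ≤ (l e).re) {z : G.affineSpace}
    (hz : z ∈ G.chamber) :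
    ‖-∑ a, (z.1 a • G.integrand α S l z) •
        (ContinuousLinearMap.proj a : (G.Edge → ℂ) →L[ℂ] ℂ)‖ ≤
      ∑ a, (m a)⁻¹ * ‖G.integrand α S (fun e => (m e : ℂ)) z‖ := by
  rw [norm_neg]
  refine norm_sum_le_of_le _ fun a _ => ?_
  have norm_proj_le : ‖(ContinuousLinearMap.proj a : (G.Edge → ℂ) →L[ℂ] ℂ)‖ ≤ 1 :=
    ContinuousLinearMap.opNorm_le_bound _ zero_le_one fun v => by
      simpa using norm_le_pi_norm v a
  rw [norm_smul]
  exact (mul_le_of_le_one_right (norm_nonneg _) norm_proj_le).trans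
    (norm_smul_integrand_le α S hm hl hz a)

theorem IntegralsWellDefined.hasFDerivAt_hyperInt {α : G.Edge → ℝ} (hα : G.IntegralsWellDefined α)
    {l : G.Edge → ℂ} (hl : l ∈ G.rightDomain) (T : G.SpanningTree) :
    HasFDerivAt (fun l => G.hyperInt α l T)
      (-∑ a, moment α T.1 l a • (ContinuousLinearMap.proj a : (G.Edge → ℂ) →L[ℂ] ℂ)) l := by
  let m : G.Edge → ℝ := fun e => (l e).re / 4
  have m_pos (e) : 0 < m e := div_pos (hl e) four_pos
  have two_mul_m_lt (e) : 2 * m e < (l e).re := by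
    have := hl e
    simp only [m]
    linarith
  have hasFDerivAt_integral := hasFDerivAt_integral_of_dominated_of_fderiv_le
    (μ := (G.coordVolume T.1).restrict G.chamber) (F := fun l z => G.integrand α T.1 l z)
    (F' := fun l z => -∑ a, (z.1 a • G.integrand α T.1 l z) •
      (ContinuousLinearMap.proj a : (G.Edge → ℂ) →L[ℂ] ℂ))
    (bound := fun z => ∑ a, (m a)⁻¹ * ‖G.integrand α T.1 (fun e => (m e : ℂ)) z‖)
    (eventually_le_re two_mul_m_lt)
    (Eventually.of_forall fun l => (measurable_integrand α T.1 l).aestronglyMeasurable)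
    (hα T l hl)
    ((Finset.aestronglyMeasurable_fun_sum _ fun a _ =>
      ((measurable_coord a).smul (measurable_integrand α T.1 l)).aestronglyMeasurable.smul_const
        _).neg)
    (ae_restrict_of_forall_mem measurableSet_chamber fun z hz l' hl' =>
      norm_fderiv_integrand_le α T.1 m_pos hl' hz)
    (integrable_finsetSum _ fun a _ =>
      (hα T (fun e => (m e : ℂ)) m_pos).norm.const_mul _)
    (ae_of_all _ fun z l' _ => hasFDerivAt_integrand α T.1 l' z)
  refine hasFDerivAt_integral.congr_fderiv ?_
  rw [integral_neg, integral_finsetSum _ fun a _ =>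
    (hα.integrableOn_smul T.2 hl a).smul_const _]
  simp only [integral_smul_const, moment]

/-! ### The linear system for the moments -/

lemma IntegralsWellDefined.moment_eq {α : G.Edge → ℝ} (hα : G.IntegralsWellDefined α)
    {T : Finset G.Edge} (hT : G.IsSpanningTree T) {l : G.Edge → ℂ} (hl : l ∈ G.rightDomain)
    (a : G.Edge) : moment α T l a = hT.rootFlow a * treeIntegral α T l +
      ∑ i : Chord T, hT.fundamentalFlow i a * moment α T l i := by
  have integrand_eq (z : G.affineSpace) : z.1 a • G.integrand α T l z =
      hT.rootFlow a • G.integrand α T l z +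
        ∑ i : Chord T, hT.fundamentalFlow i a • z.1 i • G.integrand α T l z := by
    have coord_eq := congrFun (hT.eq_rootFlow_add_sum z.2) a
    simp only [Pi.add_apply, Finset.sum_apply, Pi.smul_apply, smul_eq_mul] at coord_eq
    rw [coord_eq, add_smul, Finset.sum_smul]
    simp only [smul_smul, mul_comm (z.1 _)]
  have integrableOn_root : IntegrableOn (fun z => hT.rootFlow a • G.integrand α T l z) G.chamber
      (G.coordVolume T) :=
    Integrable.smul (hT.rootFlow a) (hα ⟨T, hT⟩ l hl)
  have integrableOn_chord (i : Chord T) (_ : i ∈ Finset.univ) : IntegrableOn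
      (fun z => hT.fundamentalFlow i a • z.1 i • G.integrand α T l z) G.chamber
        (G.coordVolume T) :=
    Integrable.smul (hT.fundamentalFlow i a) (hα.integrableOn_smul hT hl i)
  simp only [moment, treeIntegral, integrand_eq]
  rw [integral_add integrableOn_root (integrable_finsetSum _ integrableOn_chord),
    integral_finsetSum _ integrableOn_chord]
  simp only [← Complex.real_smul, integral_smul]

lemma IsSpanningTree.sum_mul_fundamentalFlow {T : Finset G.Edge} (hT : G.IsSpanningTree T)
    {i : Chord T} {ε : G.Edge → ℤ} (hε : G.IsCycleOrientation (hT.fundamentalCycle i) ε)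
    (v : G.Edge → ℂ) :
    ∑ a, v a * hT.fundamentalFlow i a = ε i * G.linForm (hT.fundamentalCycle i) ε v := by
  rw [← sum_mul_chain, Finset.mul_sum, hT.fundamentalFlow_eq hε]
  refine Finset.sum_congr rfl fun a _ => ?_
  rw [Pi.smul_apply, smul_eq_mul]
  push_cast
  ring

section Orientation

variable {α : G.Edge → ℝ} (hα : G.IntegralsWellDefined α) {T : Finset G.Edge}
  (hT : G.IsSpanningTree T) {ε : Finset G.Edge → G.Edge → ℤ}
  (hε : ∀ C, G.IsCycle C → G.IsCycleOrientation C (ε C)) {l : G.Edge → ℂ} (hl : l ∈ G.rightDomain)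

include hα hT hε hl

lemma IntegralsWellDefined.sum_mul_moment (v : G.Edge → ℂ) :
    ∑ a, v a * moment α T l a =
      G.linForm hT.rootPath (G.pathSign G.x₀ G.δ hT.rootPath) v * treeIntegral α T l +
        ∑ i : Chord T, G.linForm (hT.fundamentalCycle i) (ε (hT.fundamentalCycle i)) v *
          (ε (hT.fundamentalCycle i) i * moment α T l i) := by
  calc ∑ a, v a * moment α T l a
      = ∑ a, v a * (hT.rootFlow a * treeIntegral α T l +
          ∑ i : Chord T, hT.fundamentalFlow i a * moment α T l i) :=
        Finset.sum_congr rfl fun a _ => by rw [hα.moment_eq hT hl a]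
    _ = (∑ a, v a * hT.rootFlow a) * treeIntegral α T l +
          ∑ i : Chord T, (∑ a, v a * hT.fundamentalFlow i a) * moment α T l i := by
        simp only [mul_add, Finset.sum_add_distrib, Finset.mul_sum, Finset.sum_mul, mul_assoc]
        rw [Finset.sum_comm (γ := Chord T)]
    _ = _ := by
        rw [IsSpanningTree.rootFlow, sum_mul_chain]
        congr! 2 with i
        rw [hT.sum_mul_fundamentalFlow (hε _ (hT.isCycle_fundamentalCycle i))]
        ring

lemma IntegralsWellDefined.linForm_mul_moment (i : Chord T) :
    G.linForm (hT.fundamentalCycle i) (ε (hT.fundamentalCycle i)) l *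
        (ε (hT.fundamentalCycle i) i * moment α T l i) =
      ∑ e ∈ hT.fundamentalCycle i, ((ε (hT.fundamentalCycle i) i * ε (hT.fundamentalCycle i) e :
        ℤ) * α e : ℂ) * treeIntegral α ((insert i.1 T).erase e) l := by
  have orientation := hε _ (hT.isCycle_fundamentalCycle i)
  have by_parts := hα.sum_mul_fundamentalFlow_mul_moment hT hl i
  rw [hT.sum_mul_fundamentalFlow orientation] at by_parts
  rw [← mul_assoc, mul_comm (G.linForm _ _ _), by_parts]
  refine Finset.sum_congr rfl fun e he => ?_
  rw [hT.fundamentalFlow_apply orientation he]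
  push_cast
  ring

end Orientation

/-! ### The matrices -/

lemma mulVec_rowMatrix (A : (G.SpanningTree → ℝ) →ₗ[ℝ] (G.SpanningTree → ℝ))
    (I : G.SpanningTree → ℂ) (T : G.SpanningTree) : (G.rowMatrix A).mulVec I T =
      Fintype.linearCombination ℝ I (A (Pi.basisFun ℝ G.SpanningTree T)) := by
  simp only [Matrix.mulVec, dotProduct, rowMatrix, Matrix.of_apply, Pi.basisFun_apply,
    Fintype.linearCombination_apply, Complex.real_smul]

lemma linearCombination_treeVec {S : Finset G.Edge} (hS : G.IsSpanningTree S)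
    (I : G.SpanningTree → ℂ) : Fintype.linearCombination ℝ I (G.treeVec S) = I ⟨S, hS⟩ := by
  have treeVec_eq : G.treeVec S = Pi.single ⟨S, hS⟩ 1 := by
    ext T
    simp only [treeVec, Pi.single_apply, Subtype.ext_iff]
  rw [treeVec_eq, Fintype.linearCombination_apply_single, one_smul]

open scoped Classical in
lemma mulVec_rowMatrix_OmegaPath (σ : Finset G.Edge) (I : G.SpanningTree → ℂ)
    (T : G.SpanningTree) :
    (G.rowMatrix (G.OmegaPath σ)).mulVec I T = if σ ⊆ T.1 then I T else 0 := by
  rw [mulVec_rowMatrix, OmegaPath, Module.Basis.constr_basis, apply_ite (DFunLike.coe _),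
    linearCombination_treeVec T.2, map_zero]

open scoped Classical in
lemma mulVec_rowMatrix_OmegaCycle (α : G.Edge → ℝ) {C : Finset G.Edge} (hC : G.IsCycle C)
    (ε : G.Edge → ℤ) (I : Finset G.Edge → ℂ) (T : G.SpanningTree) :
    (G.rowMatrix (G.OmegaCycle α C ε)).mulVec (fun T' => I T'.1) T =
      ∑ i : Chord T.1, if C = T.2.fundamentalCycle i then
        ∑ e ∈ C, ((ε i * ε e : ℤ) * α e : ℂ) * I ((insert i.1 T.1).erase e) else 0 := by
  have subset_iff (i : Chord T.1) : C ⊆ insert i.1 T.1 ↔ C = T.2.fundamentalCycle i :=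
    ⟨T.2.eq_fundamentalCycle hC, fun h => h ▸ T.2.fundamentalCycle_subset i⟩
  rw [mulVec_rowMatrix, OmegaCycle, Module.Basis.constr_basis, ← Finset.filter_filter,
    Finset.sum_filter, Finset.sum_subtype (p := (· ∉ T.1)) _ (by simp), map_sum]
  refine Finset.sum_congr rfl fun i _ => ?_
  simp only [subset_iff]
  split_ifs with hi
  · rw [map_sum]
    refine Finset.sum_congr rfl fun e he => ?_
    rw [map_smul, linearCombination_treeVec (T.2.exchange (hi ▸ he)), Complex.real_smul]
    push_cast
    rfl
  · exact map_zero _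

open scoped Classical in
lemma sum_isCycle_mul_mulVec (α : G.Edge → ℝ) (ε : Finset G.Edge → G.Edge → ℤ)
    (I : Finset G.Edge → ℂ) (c : Finset G.Edge → ℂ) (T : G.SpanningTree) :
    ∑ C : Finset G.Edge with G.IsCycle C,
        c C * (G.rowMatrix (G.OmegaCycle α C (ε C))).mulVec (fun T' => I T'.1) T =
      ∑ i : Chord T.1, c (T.2.fundamentalCycle i) * ∑ e ∈ T.2.fundamentalCycle i,
        ((ε (T.2.fundamentalCycle i) i * ε (T.2.fundamentalCycle i) e : ℤ) * α e : ℂ) *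
          I ((insert i.1 T.1).erase e) := by
  rw [Finset.sum_congr rfl fun C hC => by
    rw [mulVec_rowMatrix_OmegaCycle α (Finset.mem_filter.1 hC).2, Finset.mul_sum], Finset.sum_comm]
  refine Finset.sum_congr rfl fun i _ => ?_
  simp only [mul_ite, mul_zero]
  rw [Finset.sum_ite_eq', if_pos (by simpa using T.2.isCycle_fundamentalCycle i)]

open scoped Classical in
lemma sum_isSimplePath_mul_mulVec (I : G.SpanningTree → ℂ) (c : Finset G.Edge → ℂ)
    (T : G.SpanningTree) :
    ∑ σ : Finset G.Edge with G.IsSimplePath G.x₀ G.δ σ,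
      c σ * (G.rowMatrix (G.OmegaPath σ)).mulVec I T = c T.2.rootPath * I T := by
  rw [Finset.sum_eq_single_of_mem T.2.rootPath (by simpa using T.2.isSimplePath_rootPath),
    mulVec_rowMatrix_OmegaPath, if_pos T.2.rootPath_subset]
  intro σ hσ hne
  rw [mulVec_rowMatrix_OmegaPath,
    if_neg fun h => hne ((T.2.subset_iff_eq_rootPath (Finset.mem_filter.1 hσ).2).1 h), mul_zero]

open scoped Classical in
lemma Omega_mulVec (α : G.Edge → ℝ) (ε : Finset G.Edge → G.Edge → ℤ) (l v : G.Edge → ℂ)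
    (I : G.SpanningTree → ℂ) (T : G.SpanningTree) : (G.Omega α ε l v).mulVec I T =
      (∑ σ : Finset G.Edge with G.IsSimplePath G.x₀ G.δ σ,
        G.linForm σ (G.pathSign G.x₀ G.δ σ) v * (G.rowMatrix (G.OmegaPath σ)).mulVec I T) +
      ∑ C : Finset G.Edge with G.IsCycle C, (G.linForm C (ε C) l)⁻¹ * G.linForm C (ε C) v *
        (G.rowMatrix (G.OmegaCycle α C (ε C))).mulVec I T := by
  simp only [Omega, LinearMap.add_apply, LinearMap.coe_sum, Finset.sum_apply,
    LinearMap.smulRight_apply, Matrix.add_mulVec, Matrix.sum_mulVec, Matrix.smul_mulVec,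
    Pi.add_apply, Pi.smul_apply, LinearMap.smul_apply, smul_eq_mul]

theorem IntegralsWellDefined.Omega_mulVec_hyperInt {α : G.Edge → ℝ}
    (hα : G.IntegralsWellDefined α) {ε : Finset G.Edge → G.Edge → ℤ}
    (hε : ∀ C, G.IsCycle C → G.IsCycleOrientation C (ε C)) {l : G.Edge → ℂ}
    (hl : l ∈ G.M ε ∩ G.rightDomain) (v : G.Edge → ℂ) (T : G.SpanningTree) :
    (G.Omega α ε l v).mulVec (G.hyperInt α l) T = ∑ a, v a * moment α T.1 l a := by
  rw [hα.sum_mul_moment T.2 hε hl.2, Omega_mulVec, sum_isSimplePath_mul_mulVec,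
    show G.hyperInt α l = fun T' => treeIntegral α T'.1 l from rfl,
    sum_isCycle_mul_mulVec α ε fun S => treeIntegral α S l]
  congr! 2 with i
  have linForm_ne_zero : G.linForm (T.2.fundamentalCycle i) (ε (T.2.fundamentalCycle i)) l ≠ 0 :=
    hl.1 _ (T.2.isCycle_fundamentalCycle i)
  rw [← hα.linForm_mul_moment T.2 hε hl.2 i]
  field_simp

end PreGraph

theorem theorem3p1_general {V : Type*} (G : PreGraph V)
    (α : G.Edge → ℝ) (hα : G.IntegralsWellDefined α)
    (ε : Finset G.Edge → G.Edge → ℤ) (hε : ∀ C, G.IsCycle C → G.IsCycleOrientation C (ε C))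
    (l : G.Edge → ℂ) (hl : l ∈ G.M ε ∩ G.rightDomain) :
    DifferentiableAt ℂ (G.hyperInt α) l ∧
      ∀ v : G.Edge → ℂ,
        fderiv ℂ (G.hyperInt α) l v = -((G.Omega α ε l v).mulVec (G.hyperInt α l)) := by
  have hasFDerivAt := hasFDerivAt_pi.2 fun T => hα.hasFDerivAt_hyperInt hl.2 T
  refine ⟨hasFDerivAt.differentiableAt, fun v => ?_⟩
  rw [hasFDerivAt.fderiv]
  funext T
  rw [Pi.neg_apply, hα.Omega_mulVec_hyperInt hε hl]
  simp [mul_comm (v _)]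

theorem theorem3p1 {V : Type*} [Fintype V] (G : RootedGraph V)
    (α : G.Edge → ℝ) (hα : G.IntegralsWellDefined α)
    (ε : Finset G.Edge → G.Edge → ℤ) (hε : ∀ C, G.IsCycle C → G.IsCycleOrientation C (ε C))
    (l : G.Edge → ℂ) (hl : l ∈ G.M ε ∩ G.rightDomain) :
    DifferentiableAt ℂ (G.hyperInt α) l ∧
      ∀ v : G.Edge → ℂ,
        fderiv ℂ (G.hyperInt α) l v = -((G.Omega α ε l v).mulVec (G.hyperInt α l)) :=
  theorem3p1_general G.toPreGraph α hα ε hε l hl
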